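/- Let $\nu$ be a probability distribution on $\mathbb{R}$ with mean $0$ and variance $1$, let $\varphi(\theta)=\int e^{\theta x}\,\nu(dx)$ and $\theta_\star=\sup\{\theta:\varphi(\theta)<\infty\}\in[0,\infty]$. For $\theta\in[0,\theta_\star)$ let $f_\theta(x)=\exp\{\theta x-\log\varphi(\theta)\}$, a probability density with respect to $\nu$. Let $\mathbf{X}=(X_{ij})$ be an $M\times N$ random matrix with independent entries such that $X_{ij}$ has density $f_\theta$ with respect to $\nu$ if $(i,j)\in I^*\times J^*$ and $X_{ij}\sim\nu$ otherwise, where $I^*\subset[M]$, $J^*\subset[N]$, $|I^*|=m^*$, $|J^*|=n^*$. Here $\nu$ is fixed, while $\theta$, $I^*$, $J^*$ may change with $(M,N,m^*,n^*)$; assume that $\theta$ stays in a fixed compact interval $[0,\bar\theta]\subset[0,\theta_\star)$. Fix $\delta>0$, put $$\lambda_{m,n}=\sqrt{(2+\delta)\log\Big[MN\tbinom{M}{m}\tbinom{N}{n}\Big]},$$ $$\theta_1=C\max\left\{\sqrt{\frac{\log(M-m^*)+\log m^*}{n^*}},\ \sqrt{\frac{\log(N-n^*)+\log n^*}{m^*}},\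 \frac{\lambda_{m^*,n^*}}{\sqrt{m^*n^*}}\right\},$$ where $C>1$ is the solution of $C=2\big([C/(C-1)]^{1.5}+[C/(C-1)]^{1.25}\big)$. Consider the asymptotic regime $$M,N,m^*,n^*\to\infty,\qquad \frac{\max(m^*,n^*)}{\min(M,N)}\to0,\qquad \frac{\max(\log M,\log N)}{\min(m^*,n^*)}\to0,$$ and let $\underline m\le m^*$, $\underline n\le n^*$ be such that $\log N=o(\underline m)$ and $\log M=o(\underline n)$. If $$\liminf\ \theta/\theta_1>1,$$ then, with probability tending to $1$, the pair $(I^*,J^*)$ is the unique maximizer of $$\frac{\sum_{(i,j)\in I\times J}X_{ij}}{\sqrt{|I||J|}}-\lambda_{|I|,|J|}$$ over all $I\subset[M]$, $J\subset[N]$ with $|I|\ge\underline m$ and $|J|\ge\underline n$. -/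

import Mathlib

open MeasureTheory ProbabilityTheory Filter Topology
open scoped Asymptotics

/-- The right end point `θ⋆ = sup {θ : φ(θ) < ∞}` of the domain of the moment generating function
`φ(θ) = ∫ exp (θ x) ν(dx)` of `ν`; it may be `+∞`. -/
noncomputable def thetaStar (ν : Measure ℝ) : EReal :=
  sSup ((fun t : ℝ => (t : EReal)) '' {t : ℝ | Integrable (fun x : ℝ => Real.exp (t * x)) ν})

/-- The member with parameter `θ` of the one-parameter exponential family with base measure `ν`:
density `x ↦ exp (θ x) / φ(θ) = exp (θ x - log φ(θ))` with respect to `ν`. -/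
noncomputable def expFamily (ν : Measure ℝ) (θ : ℝ) : Measure ℝ :=
  ν.tilted (fun x : ℝ => θ * x)

/-- The penalty `λ_{m,n} = √((2 + δ) log [M N (M choose m) (N choose n)])`. -/
noncomputable def penalty (δ : ℝ) (M N m n : ℕ) : ℝ :=
  Real.sqrt ((2 + δ) * Real.log ((M : ℝ) * (N : ℝ) * (M.choose m : ℝ) * (N.choose n : ℝ)))

/-- The penalized score of the submatrix of `X` with row set `S.1` and column set `S.2`. -/
noncomputable def scanScore {M N : ℕ} (δ : ℝ) (X : Fin M → Fin N → ℝ)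
    (S : Finset (Fin M) × Finset (Fin N)) : ℝ :=
  (∑ i ∈ S.1, ∑ j ∈ S.2, X i j) / Real.sqrt ((S.1.card : ℝ) * (S.2.card : ℝ))
    - penalty δ M N S.1.card S.2.card

/-- The submatrices that are scanned: at least `mlow` rows and at least `nlow` columns. -/
def scanRange (M N mlow nlow : ℕ) : Set (Finset (Fin M) × Finset (Fin N)) :=
  {S | mlow ≤ S.1.card ∧ nlow ≤ S.2.card}

/-- The set of maximizers of the penalized score over the scanned submatrices. -/
def scanArgmax {M N : ℕ} (δ : ℝ) (mlow nlow : ℕ) (X : Fin M → Fin N → ℝ) :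
    Set (Finset (Fin M) × Finset (Fin N)) :=
  {S | S ∈ scanRange M N mlow nlow ∧ IsMaxOn (scanScore δ X) (scanRange M N mlow nlow) S}

/-- The threshold `θ₁` for an anomalous `m × n` submatrix of an `M × N` matrix. -/
noncomputable def thetaOne (C δ : ℝ) (M N m n : ℕ) : ℝ :=
  C * max (Real.sqrt ((Real.log ((M : ℝ) - (m : ℝ)) + Real.log (m : ℝ)) / (n : ℝ)))
    (max (Real.sqrt ((Real.log ((N : ℝ) - (n : ℝ)) + Real.log (n : ℝ)) / (m : ℝ)))
      (penalty δ M N m n / Real.sqrt ((m : ℝ) * (n : ℝ))))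

/-! Let `T` be the planted submatrix, `μ` the mean of its entries, `P` and `Q` the square roots of
the numbers of cells of `S` and `T`, and `s` the number of common cells. The score of `S` is `(μ s +
W_S) / P - λ_S`, where `W_S` is the noise sum (`scanScore_eq`). Above the threshold, `λ_T ≤ (10/51)
μ Q`.

If `s ≤ (4/5) P Q`, the signal lost, at least `μ Q / 5`, exceeds `λ_T`, and `W_S / P` is absorbed by
`λ_S` up to a small fraction of `μ Q`. A Chernoff bound with tilt `λ_S / P` proves the latter for
all `S` at once, since the binomial coefficients in `λ_S` pay for the number of submatrices of each
size (`PlantedModel.scan_noise`).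

If `s > (4/5) P Q`, what matters is `W_S - W_T`, which lives on the symmetric difference of the two
cell sets. Its tail is at most `exp (-ℓr) ^ a * exp (-ℓc) ^ b`, where `a` rows and `b` columns are
exchanged (`PlantedModel.swap_noise`). Summing over all `S` gives a product that tends to `1`, and
the term of `T` itself is that `1`.

These two cases are combined in `scanArgmax_eq_singleton` and `PlantedModel.recovery`. The tails
come from `exists_subgaussian_expFamily`: for small `θ` the planted law has mean at least `(1 - ε)
θ` and variance proxy `1 + ε`; for the other `θ` in the compact interval the proxy `K` may be large,
but the mean is bounded below while the penalties and logarithmic terms are negligible. The equation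
for `C` enters only through `C > 26/5`. -/

/-! ### Exponential moments of `ν` and sub-Gaussian bounds. -/

/-- Second order upper bound for a function on `[0, B]` with second derivative at most `V`. -/
lemma le_quadratic_of_second_deriv_le {f D E : ℝ → ℝ} {B V : ℝ}
    (hf : ContinuousOn f (Set.Icc 0 B)) (hD : ContinuousOn D (Set.Icc 0 B))
    (hf' : ∀ t ∈ Set.Ioo 0 B, HasDerivAt f (D t) t)
    (hD' : ∀ t ∈ Set.Ioo 0 B, HasDerivAt D (E t) t)
    (hE : ∀ t ∈ Set.Ioo 0 B, E t ≤ V) {x t : ℝ}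
    (hx : x ∈ Set.Icc 0 B) (ht : t ∈ Set.Icc 0 B) :
    f t ≤ f x + (t - x) * D x + V * (t - x) ^ 2 / 2 := by
  have hLip : ∀ y ∈ Set.Icc 0 B, ∀ z ∈ Set.Icc 0 B, y ≤ z → D z - D y ≤ V * (z - y) := by
    refine (convex_Icc 0 B).image_sub_le_mul_sub_of_deriv_le hD ?_ ?_
    · rw [interior_Icc]
      exact fun t ht => (hD' t ht).differentiableAt.differentiableWithinAt
    · rw [interior_Icc]
      exact fun t ht => (hD' t ht).deriv ▸ hE t ht
  set g : ℝ → ℝ := fun u => f x + (u - x) * D x + V * (u - x) ^ 2 / 2 - f u with hg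
  have hgc : ContinuousOn g (Set.Icc 0 B) := by
    have : ContinuousOn (fun u => f x + (u - x) * D x + V * (u - x) ^ 2 / 2) (Set.Icc 0 B) := by
      fun_prop
    exact this.sub hf
  have hg' : ∀ u ∈ Set.Ioo 0 B, HasDerivAt g (D x + V * (u - x) - D u) u := by
    intro u hu
    have h1 : HasDerivAt (fun u : ℝ => u - x) 1 u := (hasDerivAt_id u).sub_const x
    have h2 := (((h1.mul_const (D x)).const_add (f x)).add
      (((h1.pow 2).const_mul V).div_const 2)).sub (hf' u hu)
    refine h2.congr_deriv ?_
    simp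
    ring
  have hgx : g x = 0 := by simp [hg]
  suffices 0 ≤ g t by simp only [hg] at this; linarith
  rcases le_total x t with h | h
  · have hm : MonotoneOn g (Set.Icc x B) := by
      have hsub : Set.Ioo x B ⊆ Set.Ioo 0 B := Set.Ioo_subset_Ioo_left hx.1
      refine monotoneOn_of_deriv_nonneg (convex_Icc x B)
        (hgc.mono (Set.Icc_subset_Icc_left hx.1)) ?_ ?_ <;> rw [interior_Icc]
      · exact fun u hu => (hg' u (hsub hu)).differentiableAt.differentiableWithinAt
      · intro u hu
        rw [(hg' u (hsub hu)).deriv]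
        have := hLip x hx u (Set.Ioo_subset_Icc_self (hsub hu)) hu.1.le
        linarith
    rw [← hgx]
    exact hm ⟨le_rfl, hx.2⟩ ⟨h, ht.2⟩ h
  · have hm : AntitoneOn g (Set.Icc 0 x) := by
      have hsub : Set.Ioo 0 x ⊆ Set.Ioo 0 B := Set.Ioo_subset_Ioo_right hx.2
      refine antitoneOn_of_deriv_nonpos (convex_Icc 0 x)
        (hgc.mono (Set.Icc_subset_Icc_right hx.2)) ?_ ?_ <;> rw [interior_Icc]
      · exact fun u hu => (hg' u (hsub hu)).differentiableAt.differentiableWithinAt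
      · intro u hu
        rw [(hg' u (hsub hu)).deriv]
        have := hLip u (Set.Ioo_subset_Icc_self (hsub hu)) x hx hu.2.le
        linarith
    rw [← hgx]
    exact hm ⟨ht.1, h⟩ ⟨hx.1, le_rfl⟩ h

/-- The exponential moments `∫ x ^ k exp (t x) ν(dx)`. -/
noncomputable def expMoment (ν : Measure ℝ) (k : ℕ) (t : ℝ) : ℝ := ∫ x, x ^ k * Real.exp (t * x) ∂ν

section ExpMoment

variable {ν : Measure ℝ} [IsProbabilityMeasure ν] {B B' : ℝ}

lemma Ioo_subset_interior_integrableExpSet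
    (hB' : Integrable (fun x : ℝ => Real.exp (B' * x)) ν) :
    Set.Ioo 0 B' ⊆ interior (integrableExpSet (fun x : ℝ => x) ν) := by
  refine interior_maximal (fun t ht => ?_) isOpen_Ioo
  exact integrable_exp_mul_of_nonneg_of_le hB' ht.1.le ht.2.le

lemma hasDerivAt_expMoment (hB' : Integrable (fun x : ℝ => Real.exp (B' * x)) ν) (k : ℕ) {t : ℝ}
    (ht : t ∈ Set.Ioo 0 B') : HasDerivAt (expMoment ν k) (expMoment ν (k + 1) t) t :=
  hasDerivAt_integral_pow_mul_exp_real (Ioo_subset_interior_integrableExpSet hB' ht) k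

/-- The point `0` may be the left end of the domain of the moment generating function, so
differentiability does not give continuity there. Dominated convergence does: `|x| ^ k` dominates
for `x ≤ 0` and `|x| ^ k * exp (B x)` for `x ≥ 0`. -/
lemma continuousOn_expMoment (hB' : Integrable (fun x : ℝ => Real.exp (B' * x)) ν) (hB : 0 < B)
    (hBB' : B < B') (k : ℕ) (hk : Integrable (fun x : ℝ => x ^ k) ν) :
    ContinuousOn (expMoment ν k) (Set.Icc 0 B) := by
  have hint := integrable_pow_mul_exp_of_mem_interior_integrableExpSet
    (Ioo_subset_interior_integrableExpSet hB' ⟨hB, hBB'⟩) k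
  refine continuousOn_of_dominated (bound := fun x => ‖x ^ k‖ + ‖x ^ k * Real.exp (B * x)‖)
    ?_ ?_ (hk.norm.add hint.norm) ?_
  · intro t _
    exact Measurable.aestronglyMeasurable (by fun_prop)
  · intro t ht
    refine Eventually.of_forall fun x => ?_
    rw [norm_mul, norm_mul, Real.norm_eq_abs (Real.exp _), Real.norm_eq_abs (Real.exp _),
      Real.abs_exp, Real.abs_exp]
    rcases le_total x 0 with hx | hx
    · have : Real.exp (t * x) ≤ 1 :=
        Real.exp_le_one_iff.2 (mul_nonpos_of_nonneg_of_nonpos ht.1 hx)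
      have h2 := mul_le_mul_of_nonneg_left this (norm_nonneg (x ^ k))
      have h3 : 0 ≤ ‖x ^ k‖ * Real.exp (B * x) := by positivity
      linarith
    · have : Real.exp (t * x) ≤ Real.exp (B * x) :=
        Real.exp_le_exp.2 (mul_le_mul_of_nonneg_right ht.2 hx)
      have h2 := mul_le_mul_of_nonneg_left this (norm_nonneg (x ^ k))
      have h3 : 0 ≤ ‖x ^ k‖ := norm_nonneg _
      linarith
  · refine Eventually.of_forall fun x => ?_
    fun_prop

lemma expMoment_zero_pos (hB' : Integrable (fun x : ℝ => Real.exp (B' * x)) ν) {t : ℝ}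
    (h0 : 0 ≤ t) (ht : t ≤ B') : 0 < expMoment ν 0 t := by
  simp only [expMoment, pow_zero, one_mul]
  exact integral_exp_pos (integrable_exp_mul_of_nonneg_of_le hB' h0 ht)

/-- Centering an exponential family member at any point `c`. -/
lemma integral_exp_expFamily (hB' : Integrable (fun x : ℝ => Real.exp (B' * x)) ν) {t s : ℝ} (c : ℝ)
    (h0 : 0 ≤ t) (ht : t ≤ B') (h0' : 0 ≤ t + s) (ht' : t + s ≤ B') :
    Integrable (fun x => Real.exp (s * (x - c))) (expFamily ν t) ∧
    ∫ x, Real.exp (s * (x - c)) ∂(expFamily ν t)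
      = Real.exp (Real.log (expMoment ν 0 (t + s)) - Real.log (expMoment ν 0 t) - s * c) := by
  have hi := integrable_exp_mul_of_nonneg_of_le hB' h0' ht'
  have hp := expMoment_zero_pos hB' h0 ht
  have hp' := expMoment_zero_pos hB' h0' ht'
  have heq : ∀ x : ℝ, Real.exp (t * x) * Real.exp (s * (x - c))
      = Real.exp (-(s * c)) * Real.exp ((t + s) * x) := by
    intro x
    rw [← Real.exp_add, ← Real.exp_add]
    ring_nf
  constructor
  · rw [expFamily, integrable_tilted_iff]
    · simp only [smul_eq_mul, heq]
      exact hi.const_mul _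
    · exact integrable_exp_mul_of_nonneg_of_le hB' h0 ht
  · rw [expFamily, integral_tilted]
    have : ∀ x : ℝ, (Real.exp (t * x) / ∫ x, Real.exp (t * x) ∂ν) • Real.exp (s * (x - c))
        = (Real.exp (-(s * c)) / expMoment ν 0 t) * Real.exp ((t + s) * x) := by
      intro x
      rw [smul_eq_mul, div_mul_eq_mul_div, heq, div_mul_eq_mul_div]
      simp [expMoment]
    simp only [this]
    rw [integral_const_mul, Real.exp_sub, Real.exp_sub, Real.exp_log hp', Real.exp_log hp,
      Real.exp_neg]
    simp only [expMoment, pow_zero, one_mul]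
    field_simp

/-- Uniform sub-Gaussian bounds for the exponential family of a standardized measure, sharp near
the parameter `0`. -/
theorem exists_subgaussian_expFamily (hν2 : MemLp (fun x : ℝ => x) 2 ν)
    (hmean : ∫ x, x ∂ν = 0) (hvar : variance (fun x : ℝ => x) ν = 1) {b : ℝ}
    (hb : (b : EReal) < thetaStar ν) (hb0 : 0 ≤ b) {ε : ℝ} (hε : 0 < ε) (hε1 : ε < 1) :
    ∃ s₀ > 0, ∃ c₀ > 0, ∃ K ≥ 1 + ε,
      (∀ s, 0 ≤ s → s ≤ s₀ → Integrable (fun x => Real.exp (s * x)) ν ∧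
        ∫ x, Real.exp (s * x) ∂ν ≤ Real.exp ((1 + ε) * s ^ 2 / 2)) ∧
      ∀ θ, 0 < θ → θ ≤ b → ∃ μ v, (((1 - ε) * θ ≤ μ ∧ v = 1 + ε) ∨ (c₀ ≤ μ ∧ v = K)) ∧
        0 < μ ∧ μ ≤ v * s₀ ∧
        ∀ s, -μ ≤ v * s → s ≤ s₀ →
          Integrable (fun x => Real.exp (s * (x - μ))) (expFamily ν θ) ∧
          ∫ x, Real.exp (s * (x - μ)) ∂(expFamily ν θ) ≤ Real.exp (v * s ^ 2 / 2) := by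
  obtain ⟨B', hB', hbB'⟩ : ∃ B', Integrable (fun x : ℝ => Real.exp (B' * x)) ν ∧ b < B' := by
    obtain ⟨_, ⟨t, ht, rfl⟩, h⟩ := lt_sSup_iff.1 hb
    exact ⟨t, ht, EReal.coe_lt_coe_iff.1 h⟩
  -- Strictly between `b` and `B'`: parameters up to `b` can still be tilted upwards, and moments of
  -- every order exist on `(0, B]`.
  set B := (b + B') / 2 with hBdef
  have hB0 : 0 < B := by rw [hBdef]; linarith
  have hbB : b < B := by rw [hBdef]; linarith
  have hBB' : B < B' := by rw [hBdef]; linarith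
  have hi2 : Integrable (fun x : ℝ => x ^ 2) ν := hν2.integrable_sq
  have hi1 : Integrable (fun x : ℝ => x) ν := hν2.integrable (by norm_num)
  have h20 : expMoment ν 2 0 = 1 := by
    have h := variance_eq_sub hν2
    rw [hvar, hmean] at h
    simp only [Pi.pow_apply] at h
    simp only [expMoment, zero_mul, Real.exp_zero, mul_one]
    linarith
  have h10 : expMoment ν 1 0 = 0 := by simpa [expMoment] using hmean
  have h00 : expMoment ν 0 0 = 1 := by simp [expMoment]
  have c0 := continuousOn_expMoment hB' hB0 hBB' 0 (by simp)
  have c1 := continuousOn_expMoment hB' hB0 hBB' 1 (by simpa using hi1)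
  have c2 := continuousOn_expMoment hB' hB0 hBB' 2 hi2
  have hpos : ∀ t ∈ Set.Icc 0 B, 0 < expMoment ν 0 t := fun t ht =>
    expMoment_zero_pos hB' ht.1 (ht.2.trans hBB'.le)
  have hne : ∀ t ∈ Set.Icc 0 B, expMoment ν 0 t ≠ 0 := fun t ht => (hpos t ht).ne'
  set L : ℝ → ℝ := fun t => Real.log (expMoment ν 0 t) with hL
  set D : ℝ → ℝ := fun t => expMoment ν 1 t / expMoment ν 0 t with hD
  set E : ℝ → ℝ := fun t => expMoment ν 2 t / expMoment ν 0 t - D t ^ 2 with hE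
  have cL : ContinuousOn L (Set.Icc 0 B) := c0.log hne
  have cD : ContinuousOn D (Set.Icc 0 B) := c1.div c0 hne
  have cE : ContinuousOn E (Set.Icc 0 B) := (c2.div c0 hne).sub (cD.pow 2)
  have dL : ∀ t ∈ Set.Ioo 0 B, HasDerivAt L (D t) t := fun t ht =>
    (hasDerivAt_expMoment hB' 0 ⟨ht.1, ht.2.trans hBB'⟩).log (hne t (Set.Ioo_subset_Icc_self ht))
  have dD : ∀ t ∈ Set.Ioo 0 B, HasDerivAt D (E t) t := by
    intro t ht
    have ht' : t ∈ Set.Ioo 0 B' := ⟨ht.1, ht.2.trans hBB'⟩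
    have hn := hne t (Set.Ioo_subset_Icc_self ht)
    refine ((hasDerivAt_expMoment hB' 1 ht').div (hasDerivAt_expMoment hB' 0 ht') hn).congr_deriv ?_
    simp only [hE, hD]
    field_simp
  have L0 : L 0 = 0 := by simp [hL, h00]
  have D0 : D 0 = 0 := by simp [hD, h10]
  have E0 : E 0 = 1 := by simp [hE, h20, h00, D0]
  -- `E t` is the variance of the tilted measure.
  have hEnn : ∀ t ∈ Set.Ioo 0 B, 0 ≤ E t := by
    intro t ht
    have hti := Ioo_subset_interior_integrableExpSet hB' ⟨ht.1, ht.2.trans hBB'⟩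
    have h1 := iteratedDeriv_two_cgf hti
    have h2 := variance_tilted_mul hti
    have h3 := deriv_cgf hti
    have : E t = iteratedDeriv 2 (cgf (fun x : ℝ => x) ν) t := by
      rw [h1, h3]
      simp only [hE, hD, expMoment, mgf]
      simp
    rw [this, ← h2]
    exact variance_nonneg _ _
  obtain ⟨r, hr0, hrB, hr⟩ : ∃ r > 0, r ≤ B ∧ ∀ t ∈ Set.Icc 0 r, |E t - 1| < ε := by
    have h := cE 0 ⟨le_rfl, hB0.le⟩
    rw [Metric.continuousWithinAt_iff] at h
    obtain ⟨d, hd, hd'⟩ := h ε hε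
    refine ⟨min (d / 2) B, by positivity, min_le_right _ _, fun t ht => ?_⟩
    have h1 : t ≤ d / 2 := ht.2.trans (min_le_left _ _)
    have := hd' (x := t) ⟨ht.1, ht.2.trans (min_le_right _ _)⟩ (by
      rw [Real.dist_eq, sub_zero, abs_of_nonneg ht.1]; linarith)
    rwa [Real.dist_eq, E0] at this
  obtain ⟨K₀, hK₀⟩ : ∃ K₀, ∀ t ∈ Set.Icc 0 B, E t ≤ K₀ := by
    obtain ⟨K₀, h⟩ := isCompact_Icc.bddAbove_image cE
    exact ⟨K₀, fun t ht => h ⟨t, ht, rfl⟩⟩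
  -- With `r / 2`, a tilt of a parameter `θ ≤ s₀` stays where `E` is within `ε` of `1`; with `B -
  -- b`, a tilt of any `θ ≤ b` stays below `B`.
  set s₀ := min (r / 2) (B - b) with hs₀
  have hs₀0 : 0 < s₀ := lt_min (by linarith) (by linarith)
  have hs₀r : s₀ ≤ r / 2 := min_le_left _ _
  have hs₀b : s₀ ≤ B - b := min_le_right _ _
  have sub1 : Set.Icc 0 r ⊆ Set.Icc 0 B := Set.Icc_subset_Icc_right hrB
  have sub2 : Set.Ioo 0 r ⊆ Set.Ioo 0 B := Set.Ioo_subset_Ioo_right hrB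
  have taylor_small : ∀ x ∈ Set.Icc 0 r, ∀ t ∈ Set.Icc 0 r,
      L t ≤ L x + (t - x) * D x + (1 + ε) * (t - x) ^ 2 / 2 := fun x hx t ht =>
    le_quadratic_of_second_deriv_le (cL.mono sub1) (cD.mono sub1)
      (fun u hu => dL u (sub2 hu)) (fun u hu => dD u (sub2 hu))
      (fun u hu => by
        have := (abs_lt.1 (hr u (Set.Ioo_subset_Icc_self hu))).2
        linarith) hx ht
  have D_lower : ∀ t ∈ Set.Icc 0 r, (1 - ε) * t ≤ D t := by
    intro t ht
    have := (convex_Icc 0 r).mul_sub_le_image_sub_of_le_deriv (cD.mono sub1) (C := 1 - ε)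
      (by rw [interior_Icc]
          exact fun u hu => (dD u (sub2 hu)).differentiableAt.differentiableWithinAt)
      (by rw [interior_Icc]
          intro u hu
          rw [(dD u (sub2 hu)).deriv]
          have := (abs_lt.1 (hr u (Set.Ioo_subset_Icc_self hu))).1
          linarith) 0 ⟨le_rfl, hr0.le⟩ t ht ht.1
    rw [D0] at this
    linarith
  have D_upper : ∀ R V, R ≤ B → (∀ u ∈ Set.Icc 0 R, E u ≤ V) → ∀ t ∈ Set.Icc 0 R, D t ≤ V * t := by
    intro R V hR hV t ht
    have s1 : Set.Icc 0 R ⊆ Set.Icc 0 B := Set.Icc_subset_Icc_right hR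
    have s2 : Set.Ioo 0 R ⊆ Set.Ioo 0 B := Set.Ioo_subset_Ioo_right hR
    have := (convex_Icc 0 R).image_sub_le_mul_sub_of_deriv_le (cD.mono s1) (C := V)
      (by rw [interior_Icc]
          exact fun u hu => (dD u (s2 hu)).differentiableAt.differentiableWithinAt)
      (by rw [interior_Icc]
          intro u hu
          rw [(dD u (s2 hu)).deriv]
          exact hV u (Set.Ioo_subset_Icc_self hu)) 0 ⟨le_rfl, ht.1.trans ht.2⟩ t ht ht.1
    rw [D0] at this
    linarith
  have D_mono : MonotoneOn D (Set.Icc 0 B) := by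
    refine monotoneOn_of_deriv_nonneg (convex_Icc 0 B) cD ?_ ?_ <;> rw [interior_Icc]
    · exact fun u hu => (dD u hu).differentiableAt.differentiableWithinAt
    · intro u hu
      rw [(dD u hu).deriv]
      exact hEnn u hu
  -- The entry `D b / s₀` ensures `μ ≤ K * s₀`, which makes tilts of order `μ / K` admissible.
  set K := max (1 + ε) (max K₀ (D b / s₀)) with hK
  have hK1 : 1 + ε ≤ K := le_max_left _ _
  have hK2 : K₀ ≤ K := (le_max_left _ _).trans (le_max_right _ _)
  have hK3 : D b / s₀ ≤ K := (le_max_right _ _).trans (le_max_right _ _)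
  have conclude : ∀ θ v s, 0 ≤ θ → θ ≤ B → 0 ≤ θ + s → θ + s ≤ B →
      L (θ + s) ≤ L θ + ((θ + s) - θ) * D θ + v * ((θ + s) - θ) ^ 2 / 2 →
      Integrable (fun x => Real.exp (s * (x - D θ))) (expFamily ν θ) ∧
          ∫ x, Real.exp (s * (x - D θ)) ∂(expFamily ν θ) ≤ Real.exp (v * s ^ 2 / 2) := by
    intro θ v s h1 h2 h3 h4 h5
    have := integral_exp_expFamily hB' (D θ) h1 (h2.trans hBB'.le) h3 (h4.trans hBB'.le)
    refine ⟨this.1, ?_⟩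
    rw [this.2, Real.exp_le_exp]
    rw [add_sub_cancel_left] at h5
    simp only [hL] at h5
    linarith
  refine ⟨s₀, hs₀0, (1 - ε) * s₀, by nlinarith, K, hK1, ?_, ?_⟩
  · intro s h0 h1
    refine ⟨integrable_exp_mul_of_nonneg_of_le hB' h0 (by linarith), ?_⟩
    have h := taylor_small 0 ⟨le_rfl, hr0.le⟩ s ⟨h0, by linarith⟩
    rw [L0, D0] at h
    have hp := hpos s ⟨h0, by linarith⟩
    have : ∫ x, Real.exp (s * x) ∂ν = expMoment ν 0 s := by simp [expMoment]
    rw [this, ← Real.log_le_iff_le_exp hp]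
    simp only [hL] at h
    calc _ ≤ _ := h
      _ = _ := by ring
  · intro θ hθ0 hθb
    have hθB : θ ∈ Set.Icc 0 B := ⟨hθ0.le, by linarith⟩
    rcases le_total θ s₀ with hθ | hθ
    · have hθr : θ ∈ Set.Icc 0 r := ⟨hθ0.le, by linarith⟩
      have hDl := D_lower θ hθr
      have hDu := D_upper r (1 + ε) hrB (fun u hu => by
        have := (abs_lt.1 (hr u hu)).2
        linarith) θ hθr
      have hD0 : 0 < D θ := lt_of_lt_of_le (mul_pos (by linarith) hθ0) hDl
      refine ⟨D θ, 1 + ε, Or.inl ⟨hDl, rfl⟩, hD0, hDu.trans (by gcongr), fun s hs hs' => ?_⟩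
      -- Since `D θ ≤ (1 + ε) * θ`, the constraint on `s` gives `s ≥ -θ`: a downward tilt never
      -- leaves the nonnegative parameters.
      have h0 : 0 ≤ θ + s := by
        by_contra! hc
        nlinarith
      exact conclude θ _ s hθB.1 hθB.2 h0 (by linarith)
        (taylor_small θ hθr (θ + s) ⟨h0, by linarith⟩)
    · have hDl : (1 - ε) * s₀ ≤ D θ :=
        (D_lower s₀ ⟨hs₀0.le, by linarith⟩).trans
          (D_mono ⟨hs₀0.le, by linarith⟩ hθB hθ)
      have hDu := D_upper B K le_rfl (fun u hu => (hK₀ u hu).trans hK2) θ hθB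
      have hD0 : 0 < D θ := lt_of_lt_of_le (mul_pos (by linarith) hs₀0) hDl
      refine ⟨D θ, K, Or.inr ⟨hDl, rfl⟩, hD0, ?_, fun s hs hs' => ?_⟩
      · have : D θ ≤ D b := D_mono hθB ⟨hb0, hbB.le⟩ hθb
        rw [div_le_iff₀ hs₀0] at hK3
        linarith
      · have h0 : 0 ≤ θ + s := by
          by_contra! hc
          nlinarith
        exact conclude θ _ s hθB.1 hθB.2 h0 (by linarith)
          (le_quadratic_of_second_deriv_le cL cD dL dD
            (fun u hu => (hK₀ u (Set.Ioo_subset_Icc_self hu)).trans hK2) hθB ⟨h0, by linarith⟩)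

end ExpMoment

/-! ### Chernoff bound for independent sums. -/

/-- Chernoff bound for a weighted sum of independent centered variables. -/
lemma measureReal_weighted_sum_ge_le {ι Ω : Type*} [Fintype ι] [MeasurableSpace Ω] {P : Measure Ω}
    [IsProbabilityMeasure P] {X : ι → Ω → ℝ} (hind : iIndepFun X P)
    (hX : ∀ p, AEMeasurable (X p) P) (c m ψ : ι → ℝ)
    (hint : ∀ p, Integrable (fun ω => Real.exp (c p * (X p ω - m p))) P)
    (hle : ∀ p, ∫ ω, Real.exp (c p * (X p ω - m p)) ∂P ≤ Real.exp (ψ p)) (t : ℝ) :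
    P.real {ω | t ≤ ∑ p, c p * (X p ω - m p)} ≤ Real.exp (-t + ∑ p, ψ p) := by
  set Y : ι → Ω → ℝ := fun p ω => c p * (X p ω - m p) with hY
  have hYind : iIndepFun Y P := hind.comp (fun p x => c p * (x - m p)) fun p => by fun_prop
  have hYm : ∀ p, AEMeasurable (Y p) P := fun p => ((hX p).sub_const _).const_mul _
  have hmgf : mgf (∑ p, Y p) P 1 = ∏ p, mgf (Y p) P 1 := hYind.mgf_sum₀ hYm _
  have hY1 : ∀ p, mgf (Y p) P 1 = ∫ ω, Real.exp (c p * (X p ω - m p)) ∂P := fun p => by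
    simp [mgf, hY]
  have hpos : 0 < mgf (∑ p, Y p) P 1 := by
    rw [hmgf]
    refine Finset.prod_pos fun p _ => ?_
    rw [hY1]
    exact integral_exp_pos (hint p)
  -- An undefined integral would be `0`, whereas the product formula makes this one positive.
  have hI : Integrable (fun ω => Real.exp (1 * (∑ p, Y p) ω)) P := by
    by_contra hc
    rw [mgf, integral_undef hc] at hpos
    exact lt_irrefl _ hpos
  have h := measure_ge_le_exp_mul_mgf t zero_le_one hI
  have hset : {ω | t ≤ ∑ p, c p * (X p ω - m p)} = {ω | t ≤ (∑ p, Y p) ω} := by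
    ext ω
    simp [hY]
  rw [hset, Real.exp_add, Real.exp_sum]
  refine h.trans ?_
  rw [hmgf]
  rw [neg_one_mul]
  gcongr with p _
  · exact fun _ _ => mgf_nonneg
  · rw [hY1]
    exact hle p

/-! ### Inequalities for overlapping rectangles. -/

/-- If two rectangles of areas `P ^ 2` and `Q ^ 2` share `s` cells and `s` is close to `P * Q`, then
the difference of the sides is controlled by the overlap deficit. -/
lemma mul_abs_sub_le_of_overlap {P Q s : ℝ} (hP : 0 < P) (hQ : 0 < Q) (hsP : s ≤ P ^ 2)
    (hsQ : s ≤ Q ^ 2) (h : 4 / 5 * (P * Q) < s) : Q * |P - Q| ≤ 5 / 4 * (P * Q - s) := by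
  rcases le_total Q P with hPQ | hPQ
  · rw [abs_of_nonneg (by linarith)]
    nlinarith [mul_pos hP hQ]
  · rw [abs_of_nonpos (by linarith)]
    have h1 : 4 / 5 * Q < P := by
      by_contra! hc
      nlinarith
    nlinarith [mul_nonneg (sub_nonneg.2 hPQ) (sub_nonneg.2 h1.le)]

/-- The left side, the size of the symmetric difference, is `(P - Q) ^ 2 + 2 * (P * Q - s)`. If `Q ≤
P`, then `4/5 * P < Q` gives `P - Q < Q / 4`, and `s ≤ Q ^ 2` gives `Q * (P - Q) ≤ P * Q - s`; so
the square is at most a quarter of the deficit. -/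
lemma symmDiff_le_of_overlap {P Q s : ℝ} (hP : 0 < P) (hQ : 0 < Q) (hsP : s ≤ P ^ 2)
    (hsQ : s ≤ Q ^ 2) (h : 4 / 5 * (P * Q) < s) :
    P ^ 2 + Q ^ 2 - 2 * s ≤ 9 / 4 * (P * Q - s) := by
  rcases le_total Q P with hPQ | hPQ
  · have h1 : 4 / 5 * P < Q := by
      by_contra! hc
      nlinarith
    nlinarith [mul_nonneg (sub_nonneg.2 hPQ) (sub_nonneg.2 h1.le)]
  · have h1 : 4 / 5 * Q < P := by
      by_contra! hc
      nlinarith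
    nlinarith [mul_nonneg (sub_nonneg.2 hPQ) (sub_nonneg.2 h1.le)]

/-- A one-dimensional overlap estimate: `a` is the size of the intersection of two sets of sizes
`m` and `m'`, and `u = √(m m')`. -/
lemma overlap_factor {m m' a u : ℝ} (hm' : 0 < m') (ham : a ≤ m) (ham' : a ≤ m')
    (hu : 0 < u) (hu2 : u ^ 2 = m * m') (h : 4 / 5 * u < a) :
    4 / 9 * (m + m' - 2 * a) ≤ u - a ∧ 16 / 25 * m' ≤ a ∧ 4 / 5 * m' ≤ u ∧ 16 / 25 * m ≤ a := by
  have ha : 0 < a := by linarith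
  have hm : 0 < m := by linarith
  have hua : a ≤ u := by
    by_contra! hc
    nlinarith [mul_le_mul ham ham' ha.le hm.le]
  have h1 : 16 / 25 * (m * m') < a ^ 2 := by nlinarith
  have h2 : 16 / 25 * m' < a := by
    by_contra! hc
    nlinarith [mul_le_mul_of_nonneg_left ham ha.le]
  have h3 : 16 / 25 * m < a := by
    by_contra! hc
    nlinarith [mul_le_mul_of_nonneg_left ham' ha.le]
  refine ⟨?_, h2.le, ?_, h3.le⟩
  -- The difference of the two sides is `(m - a) * (m' - a)`.
  · have h4 : a * (m + m' - 2 * a) ≤ (u - a) * (u + a) := by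
      nlinarith [mul_nonneg (sub_nonneg.2 ham) (sub_nonneg.2 ham')]
    have h5 : (u - a) * (u + a) ≤ (u - a) * (9 / 4 * a) :=
      mul_le_mul_of_nonneg_left (by linarith) (by linarith)
    have h6 : a * (m + m' - 2 * a) ≤ a * ((u - a) * (9 / 4)) := by linarith
    have := le_of_mul_le_mul_left h6 ha
    linarith
  · have h4 : u ^ 2 ≥ (4 / 5 * m') ^ 2 := by
      have : 16 / 25 * m' ≤ m := h2.le.trans ham
      nlinarith
    exact le_of_sq_le_sq h4 hu.le

/-- Turns the loss of overlap into a cost per exchanged row and column. Split it as `(u - a) * w +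
(w - c) * a` and apply `overlap_factor` in each dimension; the constant is `4/9 * 16/25`. -/
lemma overlap_deficit {m m' a n n' c u w : ℝ} (hm' : 0 < m') (ham : a ≤ m) (ham' : a ≤ m')
    (hu : 0 < u) (hu2 : u ^ 2 = m * m') (hn' : 0 < n') (hcn : c ≤ n) (hcn' : c ≤ n')
    (hw : 0 < w) (hw2 : w ^ 2 = n * n') (ha : 4 / 5 * u < a) (hc : 4 / 5 * w < c) :
    64 / 225 * ((m + m' - 2 * a) * n' + (n + n' - 2 * c) * m') ≤ u * w - a * c := by
  obtain ⟨h1, h2, h3, -⟩ := overlap_factor hm' ham ham' hu hu2 ha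
  obtain ⟨k1, k2, k3, -⟩ := overlap_factor hn' hcn hcn' hw hw2 hc
  have e : u * w - a * c = (u - a) * w + (w - c) * a := by ring
  have hp : 0 ≤ m + m' - 2 * a := by linarith
  have hp' : 0 ≤ n + n' - 2 * c := by linarith
  have f1 : 4 / 9 * (m + m' - 2 * a) * (4 / 5 * n') ≤ (u - a) * w :=
    mul_le_mul h1 k3 (by positivity) (by linarith)
  have f2 : 4 / 9 * (n + n' - 2 * c) * (16 / 25 * m') ≤ (w - c) * a :=
    mul_le_mul k1 h2 (by positivity) (by linarith)
  have f3 := mul_nonneg hp hn'.le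
  have f4 := mul_nonneg hp' hm'.le
  rw [e]
  nlinarith

/-! ### Binomial coefficients and penalties. -/

/-- The average of the first `m` terms of an antitone sequence decreases with `m`. -/
lemma mul_sum_range_le_of_antitoneOn {g : ℕ → ℝ} {m m' : ℕ} (hmm : m ≤ m')
    (hg : ∀ i j, i ≤ j → j < m' → g j ≤ g i) :
    (m : ℝ) * ∑ i ∈ Finset.range m', g i ≤ m' * ∑ i ∈ Finset.range m, g i := by
  induction m', hmm using Nat.le_induction with
  | base => rfl
  | succ k hk ih =>
    have ih' := ih fun i j hij hj => hg i j hij (hj.trans (Nat.lt_succ_self k))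
    have h1 : (m : ℝ) * g k ≤ ∑ i ∈ Finset.range m, g i := by
      have := Finset.card_nsmul_le_sum (Finset.range m) g (g k) fun i hi =>
        hg i k ((Finset.mem_range.1 hi).le.trans hk) (Nat.lt_succ_self k)
      simpa using this
    rw [Finset.sum_range_succ]
    push_cast
    linarith

/-- The summands decrease in `i`, which is the concavity of the logarithm of the binomial
coefficient. -/
lemma log_choose_eq_sum {M m : ℕ} (h : m ≤ M) : Real.log (M.choose m)
    = ∑ i ∈ Finset.range m, Real.log (((M : ℝ) - i) / (i + 1)) := by
  induction m with
  | zero => simp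
  | succ k ih =>
    rw [Finset.sum_range_succ, ← ih (by omega)]
    have hk : (0 : ℝ) < (M : ℝ) - k := by
      have : (k : ℝ) + 1 ≤ M := by exact_mod_cast h
      linarith
    have hc : (0 : ℝ) < M.choose k := by exact_mod_cast Nat.choose_pos (by omega)
    rw [← Real.log_mul hc.ne' (by positivity)]
    congr 1
    have := Nat.choose_succ_right_eq M k
    have h2 : (M.choose (k + 1) : ℝ) * (k + 1) = M.choose k * ((M : ℝ) - k) := by
      rw [← Nat.cast_sub (by omega)]
      exact_mod_cast this
    field_simp
    linarith

/-- For `m ≤ m'` this is concavity: the average increment over the first `m` steps is at least that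
over the first `m'`. For `m' ≤ m` binomial coefficients increase up to the middle, hence the
condition `2 * m ≤ M`. -/
lemma mul_log_choose_le {M m m' : ℕ} {t : ℝ} (ht1 : t ≤ 1) (ht : t * m' ≤ m)
    (hm : 2 * m ≤ M) (hm' : m' ≤ M) :
    t * Real.log (M.choose m') ≤ Real.log (M.choose m) := by
  have hnn : ∀ k, 0 ≤ Real.log (M.choose k : ℝ) := fun k => Real.log_natCast_nonneg _
  rcases le_total m m' with h | h
  · rcases Nat.eq_zero_or_pos m' with h0 | h0
    · obtain rfl : m = m' := by omega
      nlinarith [hnn m]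
    · have h0' : (0 : ℝ) < m' := by exact_mod_cast h0
      have key : (m : ℝ) * Real.log (M.choose m') ≤ m' * Real.log (M.choose m) := by
        rw [log_choose_eq_sum hm', log_choose_eq_sum (h.trans hm')]
        refine mul_sum_range_le_of_antitoneOn h fun i j hij hj => ?_
        have hjM : (j : ℝ) + 1 ≤ M := by exact_mod_cast (by omega : j + 1 ≤ M)
        have hij' : (i : ℝ) ≤ j := by exact_mod_cast hij
        refine Real.log_le_log (div_pos (by linarith) (by positivity)) ?_
        exact div_le_div₀ (by linarith) (by linarith) (by positivity) (by linarith)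
      have h2 : t * m' * Real.log (M.choose m') ≤ m * Real.log (M.choose m') :=
        mul_le_mul_of_nonneg_right ht (hnn _)
      have h3 : (m' : ℝ) * (t * Real.log (M.choose m')) ≤ m' * Real.log (M.choose m) := by
        linarith
      exact le_of_mul_le_mul_left h3 h0'
  · have hmono : M.choose m' ≤ M.choose m := by
      clear ht hm' ht1
      induction m, h using Nat.le_induction with
      | base => rfl
      | succ k hk ih =>
        exact (ih (by omega)).trans (Nat.choose_le_succ_of_lt_half_left (by omega))
    have : Real.log (M.choose m' : ℝ) ≤ Real.log (M.choose m) := by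
      rcases Nat.eq_zero_or_pos (M.choose m') with h0 | h0
      · rw [h0]
        simpa using hnn m
      · exact Real.log_le_log (by exact_mod_cast h0) (by exact_mod_cast hmono)
    nlinarith [hnn m']

lemma penalty_sq {δ : ℝ} (hδ : 0 < δ) {M N m n : ℕ} (hM : 0 < M) (hN : 0 < N) (hm : m ≤ M)
    (hn : n ≤ N) : penalty δ M N m n ^ 2 = (2 + δ) *
      (Real.log M + Real.log N + Real.log (M.choose m) + Real.log (N.choose n)) := by
  have h1 : (M : ℝ) ≠ 0 := by exact_mod_cast hM.ne'
  have h2 : (N : ℝ) ≠ 0 := by exact_mod_cast hN.ne'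
  have h3 : (M.choose m : ℝ) ≠ 0 := by exact_mod_cast (Nat.choose_pos hm).ne'
  have h4 : (N.choose n : ℝ) ≠ 0 := by exact_mod_cast (Nat.choose_pos hn).ne'
  rw [penalty, Real.log_mul (by positivity) h4, Real.log_mul (by positivity) h3,
    Real.log_mul h1 h2, Real.sq_sqrt]
  have := Real.log_natCast_nonneg M
  have := Real.log_natCast_nonneg N
  have := Real.log_natCast_nonneg (M.choose m)
  have := Real.log_natCast_nonneg (N.choose n)
  positivity

lemma penalty_nonneg (δ : ℝ) (M N m n : ℕ) : 0 ≤ penalty δ M N m n := Real.sqrt_nonneg _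

/-- Comparison of the penalties of two rectangles of which the first is not much smaller. -/
lemma mul_penalty_le {δ : ℝ} (hδ : 0 < δ) {M N m n m' n' : ℕ} (hM : 0 < M) (hN : 0 < N)
    (hm : 2 * m ≤ M) (hn : 2 * n ≤ N) (hm' : m' ≤ M) (hn' : n' ≤ N) {ρ : ℝ} (hρ0 : 0 ≤ ρ)
    (hρ1 : ρ ≤ 1) (hρm : ρ ^ 2 * m' ≤ m) (hρn : ρ ^ 2 * n' ≤ n) :
    ρ * penalty δ M N m' n' ≤ penalty δ M N m n := by
  refine le_of_sq_le_sq ?_ (penalty_nonneg _ _ _ _ _)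
  rw [mul_pow, penalty_sq (m := m) (n := n) hδ hM hN (by omega) (by omega), penalty_sq hδ hM hN hm' hn']
  have hρ2 : ρ ^ 2 ≤ 1 := pow_le_one₀ hρ0 hρ1
  have h1 := mul_log_choose_le hρ2 hρm hm hm'
  have h2 := mul_log_choose_le hρ2 hρn hn hn'
  have h3 := mul_le_mul_of_nonneg_right hρ2 (Real.log_natCast_nonneg M)
  have h4 := mul_le_mul_of_nonneg_right hρ2 (Real.log_natCast_nonneg N)
  have : ρ ^ 2 * (Real.log M + Real.log N + Real.log (M.choose m') + Real.log (N.choose n'))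
      ≤ Real.log M + Real.log N + Real.log (M.choose m) + Real.log (N.choose n) := by linarith
  nlinarith

/-! ### Deterministic comparison of two scores. -/

/-- The score of `S` is at most `0.801 * μ * Q`; that of `T` is at least `(0.999 - 10/51) * μ * Q`,
which exceeds `0.8029 * μ * Q`. -/
lemma penalized_score_lt_of_far {P Q s μ lS lT WS WT : ℝ} (hP : 0 < P) (hQ : 0 < Q) (hμ : 0 < μ)
    (h : s ≤ 4 / 5 * (P * Q)) (hWT : |WT| ≤ 1 / 1000 * μ * Q ^ 2)
    (hWS : WS ≤ P * (lS + 1 / 1000 * μ * Q)) (hl : 51 / 10 * lT ≤ μ * Q) :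
    (μ * s + WS) / P - lS < (μ * Q ^ 2 + WT) / Q - lT := by
  have h1 : (μ * s + WS) / P ≤ 4 / 5 * μ * Q + (lS + 1 / 1000 * μ * Q) := by
    rw [div_le_iff₀ hP]
    nlinarith
  have h2 : μ * Q - 1 / 1000 * μ * Q ≤ (μ * Q ^ 2 + WT) / Q := by
    rw [le_div_iff₀ hQ]
    have := (abs_le.1 hWT).1
    nlinarith
  have h3 : 0 < μ * Q := by positivity
  linarith

/-- Multiply the difference of scores by `P`. The gain `μ * (P * Q - s)` must pay for `4/5` of
itself in swap noise, `1/800` for rescaling `WT`, and `10/51` for the change of penalty; these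
fractions add up to less than `1`. -/
lemma penalized_score_lt_of_near {P Q s μ lS lT WS WT : ℝ} (hP : 0 < P) (hQ : 0 < Q) (hμ : 0 < μ)
    (h : 4 / 5 * (P * Q) < s) (hsP : s ≤ P ^ 2) (hsQ : s ≤ Q ^ 2)
    (hWT : |WT| ≤ 1 / 1000 * μ * Q ^ 2) (hW : WS - WT < 4 / 5 * μ * (P * Q - s))
    (hl : 51 / 10 * lT ≤ μ * Q) (hlS : s * lT ≤ P * Q * lS) :
    (μ * s + WS) / P - lS < (μ * Q ^ 2 + WT) / Q - lT := by
  have hdist := mul_abs_sub_le_of_overlap hP hQ hsP hsQ h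
  have hS : 0 ≤ P * Q - s := by
    have := mul_nonneg hQ.le (abs_nonneg (P - Q))
    linarith
  have h1 : |WT * (P - Q) / Q| ≤ 1 / 800 * μ * (P * Q - s) := by
    rw [abs_div, abs_mul, abs_of_pos hQ, div_le_iff₀ hQ]
    calc |WT| * |P - Q| ≤ 1 / 1000 * μ * Q ^ 2 * |P - Q| := by gcongr
      _ = 1 / 1000 * μ * Q * (Q * |P - Q|) := by ring
      _ ≤ 1 / 1000 * μ * Q * (5 / 4 * (P * Q - s)) := by gcongr
      _ = _ := by ring
  have h2 : P * (lT - lS) ≤ 10 / 51 * μ * (P * Q - s) := by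
    have : Q * (P * (lT - lS)) ≤ Q * (10 / 51 * μ * (P * Q - s)) := by
      have := mul_le_mul_of_nonneg_left hl hS
      nlinarith
    exact le_of_mul_le_mul_left this hQ
  have h3 := (abs_le.1 h1).1
  have h4 : 0 ≤ μ * (P * Q - s) := by positivity
  have h5 : P * ((μ * Q ^ 2 + WT) / Q) = μ * (P * Q) + WT + WT * (P - Q) / Q := by
    field_simp
    ring
  have h6 : P * ((μ * s + WS) / P) = μ * s + WS := by field_simp
  have h7 : P * ((μ * s + WS) / P - lS) < P * ((μ * Q ^ 2 + WT) / Q - lT) := by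
    rw [mul_sub, mul_sub, h5, h6]
    linarith
  exact lt_of_mul_lt_mul_left h7 hP.le

/-! ### Submatrices and the deterministic recovery criterion. -/

section Rectangle

variable {M N : ℕ}

/-- The cells of the submatrix with rows `S.1` and columns `S.2`. -/
def cells (S : Finset (Fin M) × Finset (Fin N)) : Finset (Fin M × Fin N) := S.1 ×ˢ S.2

/-- The square root of the number of cells. -/
noncomputable def side (S : Finset (Fin M) × Finset (Fin N)) : ℝ :=
  Real.sqrt ((S.1.card : ℝ) * (S.2.card : ℝ))

/-- The number of common cells of two submatrices. -/
def overlap (S T : Finset (Fin M) × Finset (Fin N)) : ℝ :=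
  ((S.1 ∩ T.1).card : ℝ) * ((S.2 ∩ T.2).card : ℝ)

/-- The sum over `S` of the entries of `X`, centered by `μ` on `T`. -/
noncomputable def noiseSum (μ : ℝ) (X : Fin M → Fin N → ℝ) (T S : Finset (Fin M) × Finset (Fin N)) :
    ℝ := ∑ p ∈ cells S, (X p.1 p.2 - if p ∈ cells T then μ else 0)

lemma cells_inter_card (S T : Finset (Fin M) × Finset (Fin N)) :
    ((cells S ∩ cells T).card : ℝ) = overlap S T := by
  rw [cells, cells, Finset.product_inter_product, Finset.card_product]
  simp [overlap]

lemma side_sq (S : Finset (Fin M) × Finset (Fin N)) : side S ^ 2 = S.1.card * S.2.card :=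
  Real.sq_sqrt (by positivity)

lemma cells_card (S : Finset (Fin M) × Finset (Fin N)) : ((cells S).card : ℝ) = side S ^ 2 := by
  rw [side_sq, cells, Finset.card_product]
  push_cast
  rfl

lemma side_pos {S : Finset (Fin M) × Finset (Fin N)} (h1 : 0 < S.1.card) (h2 : 0 < S.2.card) :
    0 < side S := Real.sqrt_pos.2 (by positivity)

lemma overlap_nonneg (S T : Finset (Fin M) × Finset (Fin N)) : 0 ≤ overlap S T := by
  unfold overlap
  positivity

lemma overlap_le_left (S T : Finset (Fin M) × Finset (Fin N)) : overlap S T ≤ side S ^ 2 := by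
  rw [← cells_inter_card, ← cells_card]
  exact_mod_cast Finset.card_le_card Finset.inter_subset_left

lemma overlap_le_right (S T : Finset (Fin M) × Finset (Fin N)) : overlap S T ≤ side T ^ 2 := by
  rw [← cells_inter_card, ← cells_card]
  exact_mod_cast Finset.card_le_card Finset.inter_subset_right

lemma overlap_self (S : Finset (Fin M) × Finset (Fin N)) : overlap S S = side S ^ 2 := by
  rw [side_sq]
  simp [overlap]

lemma scanScore_eq (δ μ : ℝ) (X : Fin M → Fin N → ℝ) (S T : Finset (Fin M) × Finset (Fin N)) :
    scanScore δ X S = (μ * overlap S T + noiseSum μ X T S) / side S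
      - penalty δ M N S.1.card S.2.card := by
  have h : ∑ i ∈ S.1, ∑ j ∈ S.2, X i j = μ * overlap S T + noiseSum μ X T S := by
    rw [noiseSum, Finset.sum_sub_distrib, Finset.sum_ite_mem, Finset.sum_const,
      ← cells_inter_card, nsmul_eq_mul, cells, Finset.sum_product]
    ring
  rw [scanScore, h, side]

/-- The factors of the overlap of two submatrices whose overlap is large. -/
lemma factors_of_near {S T : Finset (Fin M) × Finset (Fin N)} (hS : 0 < side S)
    (hT : 0 < side T) (h : 4 / 5 * (side S * side T) < overlap S T) :
    ∃ u w : ℝ, 0 < u ∧ 0 < w ∧ u ^ 2 = S.1.card * T.1.card ∧ w ^ 2 = S.2.card * T.2.card ∧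
      side S * side T = u * w ∧ 4 / 5 * u < (S.1 ∩ T.1).card ∧ 4 / 5 * w < (S.2 ∩ T.2).card := by
  set u := Real.sqrt ((S.1.card : ℝ) * T.1.card) with hu
  set w := Real.sqrt ((S.2.card : ℝ) * T.2.card) with hw
  have hu2 : u ^ 2 = S.1.card * T.1.card := Real.sq_sqrt (by positivity)
  have hw2 : w ^ 2 = S.2.card * T.2.card := Real.sq_sqrt (by positivity)
  have huw : side S * side T = u * w := by
    rw [side, side, hu, hw, ← Real.sqrt_mul (by positivity), ← Real.sqrt_mul (by positivity)]
    congr 1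
    ring
  have hpos : 0 < u * w := huw ▸ mul_pos hS hT
  have hu0 : 0 < u := (Real.sqrt_nonneg _).lt_of_ne fun h0 => by
    rw [hu, ← h0] at hpos
    simp at hpos
  have hw0 : 0 < w := pos_of_mul_pos_right hpos hu0.le
  have hau : ((S.1 ∩ T.1).card : ℝ) ≤ u := by
    refine Real.le_sqrt_of_sq_le ?_
    rw [sq]
    gcongr
    exacts [Finset.inter_subset_left, Finset.inter_subset_right]
  have hcw : ((S.2 ∩ T.2).card : ℝ) ≤ w := by
    refine Real.le_sqrt_of_sq_le ?_
    rw [sq]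
    gcongr
    exacts [Finset.inter_subset_left, Finset.inter_subset_right]
  rw [huw, overlap] at h
  refine ⟨u, w, hu0, hw0, hu2, hw2, huw, ?_, ?_⟩
  · by_contra! hc
    have := mul_le_mul hc hcw (by positivity) (by positivity)
    linarith
  · by_contra! hc
    have := mul_le_mul hau hc (by positivity) (by positivity)
    linarith

/-- This is `mul_penalty_le` with `ρ` the ratio of the overlap to `side S * side T`. With `a` common
rows, `ρ ^ 2 * |T.1| ≤ a ^ 2 / |S.1| ≤ |S.1|`, and likewise for columns. -/
lemma overlap_mul_penalty_le {δ : ℝ} (hδ : 0 < δ) {S T : Finset (Fin M) × Finset (Fin N)}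
    (hS : 0 < side S) (hT : 0 < side T) (hM : 4 * T.1.card ≤ M) (hN : 4 * T.2.card ≤ N)
    (h : 4 / 5 * (side S * side T) < overlap S T) :
    overlap S T * penalty δ M N T.1.card T.2.card
      ≤ side S * side T * penalty δ M N S.1.card S.2.card := by
  obtain ⟨u, w, hu, hw, hu2, hw2, huw, ha, hc⟩ := factors_of_near hS hT h
  have hcard : ∀ {n : ℕ} (A B : Finset (Fin n)), ((A ∩ B).card : ℝ) ≤ A.card ∧
      ((A ∩ B).card : ℝ) ≤ B.card := fun A B =>
    ⟨by exact_mod_cast Finset.card_le_card Finset.inter_subset_left,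
      by exact_mod_cast Finset.card_le_card Finset.inter_subset_right⟩
  obtain ⟨a1, a2⟩ := hcard S.1 T.1
  obtain ⟨c1, c2⟩ := hcard S.2 T.2
  have ha0 : (0 : ℝ) < (S.1 ∩ T.1).card := by linarith
  have hc0 : (0 : ℝ) < (S.2 ∩ T.2).card := by linarith
  have hT1 : (0 : ℝ) < T.1.card := by linarith
  have hT2 : (0 : ℝ) < T.2.card := by linarith
  obtain ⟨-, -, -, k1⟩ := overlap_factor hT1 a1 a2 hu hu2 ha
  obtain ⟨-, -, -, k2⟩ := overlap_factor hT2 c1 c2 hw hw2 hc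
  have hau : ((S.1 ∩ T.1).card : ℝ) ^ 2 ≤ u ^ 2 := by
    rw [hu2, sq]
    gcongr
  have hcw : ((S.2 ∩ T.2).card : ℝ) ^ 2 ≤ w ^ 2 := by
    rw [hw2, sq]
    gcongr
  have hST : 0 < side S * side T := mul_pos hS hT
  -- Large overlap bounds the size of `S` by `25/16` times that of `T` in each dimension, hence
  -- below half of the matrix.
  have hsz : ∀ {s a t K : ℕ}, 16 / 25 * (s : ℝ) ≤ a → (a : ℝ) ≤ t → 4 * t ≤ K → 2 * s ≤ K := by
    intro s a t K h1 h2 h3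
    have h3' : 4 * (t : ℝ) ≤ K := by exact_mod_cast h3
    have : 2 * (s : ℝ) ≤ K := by linarith
    exact_mod_cast this
  set a : ℝ := ((S.1 ∩ T.1).card : ℝ)
  set c : ℝ := ((S.2 ∩ T.2).card : ℝ)
  have hM1 : 0 < M := by
    have : 0 < T.1.card := by exact_mod_cast hT1
    omega
  have hN1 : 0 < N := by
    have : 0 < T.2.card := by exact_mod_cast hT2
    omega
  have hsq : (overlap S T / (side S * side T)) ^ 2 = (a ^ 2 / u ^ 2) * (c ^ 2 / w ^ 2) := by
    rw [huw, overlap]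
    field_simp
    rfl
  have ra : a ^ 2 / u ^ 2 ≤ 1 := (div_le_one (by positivity)).2 hau
  have rc : c ^ 2 / w ^ 2 ≤ 1 := (div_le_one (by positivity)).2 hcw
  have key := mul_penalty_le hδ (M := M) (N := N) (m := S.1.card) (n := S.2.card)
    (m' := T.1.card) (n' := T.2.card) hM1 hN1 (hsz k1 a2 hM) (hsz k2 c2 hN) (by omega) (by omega)
    (ρ := overlap S T / (side S * side T)) (div_nonneg (overlap_nonneg _ _) hST.le) ?_ ?_ ?_
  · rw [div_mul_eq_mul_div, div_le_iff₀ hST] at key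
    linarith
  · rw [div_le_one hST, huw, overlap]
    exact mul_le_mul (le_of_sq_le_sq hau hu.le) (le_of_sq_le_sq hcw hw.le) hc0.le hu.le
  · rw [hsq]
    calc a ^ 2 / u ^ 2 * (c ^ 2 / w ^ 2) * (T.1.card : ℝ) ≤ a ^ 2 / u ^ 2 * 1 * T.1.card := by gcongr
      _ = a ^ 2 / S.1.card := by
        rw [hu2]
        have : (0 : ℝ) < S.1.card := by linarith
        field_simp
      _ ≤ S.1.card := by
        rw [div_le_iff₀ (by linarith), sq]
        gcongr
  · rw [hsq]
    calc a ^ 2 / u ^ 2 * (c ^ 2 / w ^ 2) * (T.2.card : ℝ) ≤ 1 * (c ^ 2 / w ^ 2) * T.2.card := by gcongr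
      _ = c ^ 2 / S.2.card := by
        rw [hw2]
        have : (0 : ℝ) < S.2.card := by linarith
        field_simp
      _ ≤ S.2.card := by
        rw [div_le_iff₀ (by linarith), sq]
        gcongr

/-- The planted submatrix `T` is the unique maximizer of the penalized score as soon as the noise
sums are controlled. -/
theorem scanArgmax_eq_singleton {δ μ : ℝ} (hδ : 0 < δ) (hμ : 0 < μ) {mlow nlow : ℕ}
    (hmlow : 0 < mlow) (hnlow : 0 < nlow) {T : Finset (Fin M) × Finset (Fin N)}
    (hTm : mlow ≤ T.1.card) (hTn : nlow ≤ T.2.card) (hM : 4 * T.1.card ≤ M) (hN : 4 * T.2.card ≤ N)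
    (hl : 51 / 10 * penalty δ M N T.1.card T.2.card ≤ μ * side T) {X : Fin M → Fin N → ℝ}
    (h1 : |noiseSum μ X T T| ≤ 1 / 1000 * μ * side T ^ 2)
    (h2 : ∀ S ∈ scanRange M N mlow nlow, noiseSum μ X T S
      ≤ side S * (penalty δ M N S.1.card S.2.card + 1 / 1000 * μ * side T))
    (h3 : ∀ S ∈ scanRange M N mlow nlow, S ≠ T → 4 / 5 * (side S * side T) < overlap S T →
      noiseSum μ X T S - noiseSum μ X T T < 4 / 5 * μ * (side S * side T - overlap S T)) :
    scanArgmax δ mlow nlow X = {T} := by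
  have hT : 0 < side T := side_pos (by omega) (by omega)
  have hlt : ∀ S ∈ scanRange M N mlow nlow, S ≠ T → scanScore δ X S < scanScore δ X T := by
    intro S hS hne
    have hS0 : 0 < side S := side_pos (by have := hS.1; omega) (by have := hS.2; omega)
    rw [scanScore_eq δ μ X S T, scanScore_eq δ μ X T T, overlap_self]
    rcases le_or_gt (overlap S T) (4 / 5 * (side S * side T)) with h | h
    · exact penalized_score_lt_of_far hS0 hT hμ h h1 (h2 S hS) hl
    · exact penalized_score_lt_of_near hS0 hT hμ h (overlap_le_left S T) (overlap_le_right S T) h1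
        (h3 S hS hne h) hl (overlap_mul_penalty_le hδ hS0 hT hM hN h)
  have hTr : T ∈ scanRange M N mlow nlow := ⟨hTm, hTn⟩
  ext S
  simp only [scanArgmax, Set.mem_ofPred_eq, Set.mem_singleton_iff]
  constructor
  · rintro ⟨hS, hmax⟩
    by_contra hne
    exact absurd (hmax hTr) (not_le.2 (hlt S hS hne))
  · rintro rfl
    refine ⟨hTr, fun S' hS' => ?_⟩
    by_cases he : S' = S
    · exact (congrArg (scanScore δ X) he).le
    · exact (hlt S' hS' he).le

end Rectangle

/-! ### Sums over subsets for the union bounds. -/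

/-- Taking the symmetric difference with `A` permutes the subsets, which reduces the sum to the
binomial theorem. -/
lemma sum_pow_card_symmDiff {α : Type*} [Fintype α] [DecidableEq α] (A : Finset α) (x : ℝ) :
    ∑ I : Finset α, x ^ (symmDiff I A).card = (1 + x) ^ Fintype.card α := by
  have h : Function.Involutive fun I : Finset α => symmDiff I A := fun I =>
    symmDiff_symmDiff_cancel_right A I
  have h2 := Equiv.sum_comp h.toPerm (fun I : Finset α => x ^ I.card)
  simp only [Function.Involutive.coe_toPerm] at h2
  rw [h2, add_comm, ← Fintype.sum_pow_mul_eq_add_pow]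
  simp

lemma card_symmDiff_cast {α : Type*} [DecidableEq α] (A B : Finset α) :
    ((symmDiff A B).card : ℝ) = A.card + B.card - 2 * (A ∩ B).card := by
  have h1 := Finset.card_sdiff_add_card_inter A B
  have h2 := Finset.card_sdiff_add_card_inter B A
  rw [Finset.inter_comm B A] at h2
  have h3 : (symmDiff A B).card = (A \ B).card + (B \ A).card := by
    change (A \ B ∪ B \ A).card = _
    exact Finset.card_union_of_disjoint (s := A \ B) (t := B \ A)
      (Finset.disjoint_left.2 fun x hx hx' => by simp_all)
  rw [h3, ← h1, ← h2]
  push_cast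
  ring

/-- Each of the `n + 1` possible sizes contributes exactly `1`. -/
lemma sum_inv_choose_card (n : ℕ) :
    ∑ I : Finset (Fin n), ((n.choose I.card : ℝ))⁻¹ = n + 1 := by
  have := Finset.sum_powerset_apply_card (fun k => ((n.choose k : ℝ))⁻¹)
    (x := (Finset.univ : Finset (Fin n)))
  rw [Finset.powerset_univ, Finset.card_univ, Fintype.card_fin] at this
  rw [this]
  rw [Finset.sum_congr rfl (g := fun _ => (1 : ℝ)) fun k hk => ?_]
  · simp
  · have : (n.choose k : ℝ) ≠ 0 := by
      exact_mod_cast (Nat.choose_pos (by have := Finset.mem_range.1 hk; omega)).ne'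
    rw [nsmul_eq_mul, mul_inv_cancel₀ this]

/-! ### Tail bounds and recovery for fixed dimensions. -/

section Tail

variable {M N : ℕ} {Ω : Type*} [MeasurableSpace Ω] {P : Measure Ω}
  {X : Fin M → Fin N → Ω → ℝ} {T : Finset (Fin M) × Finset (Fin N)} {μ v σ s₀ : ℝ}

/-- The entries of `X` are independent, those outside of `T` have upper tails which are
sub-Gaussian with parameter `σ`, those in `T`, centered by `μ`, have tails which are sub-Gaussian
with parameter `v`; the tilts are at most `s₀`, and at least `-μ / v` in `T`. -/
structure PlantedModel (P : Measure Ω) (X : Fin M → Fin N → Ω → ℝ)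
    (T : Finset (Fin M) × Finset (Fin N)) (μ v σ s₀ : ℝ) : Prop where
  indep : iIndepFun (fun p : Fin M × Fin N => X p.1 p.2) P
  meas : ∀ p : Fin M × Fin N, AEMeasurable (X p.1 p.2) P
  out : ∀ p ∉ cells T, ∀ s, 0 ≤ s → s ≤ s₀ → Integrable (fun ω => Real.exp (s * X p.1 p.2 ω)) P ∧
    ∫ ω, Real.exp (s * X p.1 p.2 ω) ∂P ≤ Real.exp (σ * s ^ 2 / 2)
  mem : ∀ p ∈ cells T, ∀ s, -μ ≤ v * s → s ≤ s₀ →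
    Integrable (fun ω => Real.exp (s * (X p.1 p.2 ω - μ))) P ∧
    ∫ ω, Real.exp (s * (X p.1 p.2 ω - μ)) ∂P ≤ Real.exp (v * s ^ 2 / 2)
  mean_pos : 0 < μ
  tilt_pos : 0 < s₀
  one_le : 1 ≤ σ
  le_var : σ ≤ v
  mean_le : μ ≤ v * s₀

lemma PlantedModel.var_pos (h : PlantedModel P X T μ v σ s₀) : 0 < v := by
  linarith [h.one_le, h.le_var]

variable [IsProbabilityMeasure P]

/-- Negative weights are allowed only on `T`: `ν` need not have exponential moments on the negative
side, while the planted law can be tilted back towards `ν`. -/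
lemma PlantedModel.tail (h : PlantedModel P X T μ v σ s₀) (c : Fin M × Fin N → ℝ)
    (hout : ∀ p ∉ cells T, 0 ≤ c p) (hmem : ∀ p ∈ cells T, -μ ≤ v * c p) (hle : ∀ p, c p ≤ s₀)
    (t : ℝ) :
    P.real {ω | t ≤ ∑ p, c p * (X p.1 p.2 ω - if p ∈ cells T then μ else 0)} ≤
      Real.exp (-t + ∑ p, (if p ∈ cells T then v else σ) * c p ^ 2 / 2) := by
  have key : ∀ p, Integrable
        (fun ω => Real.exp (c p * (X p.1 p.2 ω - if p ∈ cells T then μ else 0))) P ∧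
      ∫ ω, Real.exp (c p * (X p.1 p.2 ω - if p ∈ cells T then μ else 0)) ∂P
        ≤ Real.exp ((if p ∈ cells T then v else σ) * c p ^ 2 / 2) := by
    intro p
    by_cases hp : p ∈ cells T
    · simp only [hp, if_true]
      exact h.mem p hp (c p) (hmem p hp) (hle p)
    · simp only [hp, if_false, sub_zero]
      exact h.out p hp (c p) (hout p hp) (hle p)
  exact measureReal_weighted_sum_ge_le h.indep h.meas c _ _ (fun p => (key p).1)
    (fun p => (key p).2) t

lemma sum_indicator_mul_eq_noiseSum (s : ℝ) (S : Finset (Fin M) × Finset (Fin N))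
    (Y : Fin M → Fin N → ℝ) :
    ∑ p, (if p ∈ cells S then s else 0) * (Y p.1 p.2 - if p ∈ cells T then μ else 0)
      = s * noiseSum μ Y T S := by
  simp only [ite_mul, zero_mul, Finset.sum_ite_mem, Finset.univ_inter, noiseSum, Finset.mul_sum]

/-- Chernoff with the optimal tilts `±μ / (1000 v)`, one for each tail. -/
lemma PlantedModel.planted_noise (h : PlantedModel P X T μ v σ s₀) :
    P.real {ω | 1 / 1000 * μ * side T ^ 2 ≤ |noiseSum μ (fun i j => X i j ω) T T|} ≤
      2 * Real.exp (-(μ ^ 2 * side T ^ 2 / (2000000 * v))) := by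
  have hv := h.var_pos
  have hμ := h.mean_pos
  have hsign : ∀ s, s = μ / (1000 * v) ∨ s = -(μ / (1000 * v)) →
      P.real {ω | μ / (1000 * v) * (1 / 1000 * μ * side T ^ 2)
        ≤ s * noiseSum μ (fun i j => X i j ω) T T}
      ≤ Real.exp (-(μ ^ 2 * side T ^ 2 / (2000000 * v))) := by
    intro s hs
    have hvs : v * s = μ / 1000 ∨ v * s = -(μ / 1000) := by
      rcases hs with rfl | rfl
      · left
        field_simp
      · right
        field_simp
    have hs2 : s ^ 2 = (μ / (1000 * v)) ^ 2 := by rcases hs with rfl | rfl <;> ring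
    have hs₀ : s ≤ s₀ := by
      have : v * s ≤ v * s₀ := by
        have := h.mean_le
        rcases hvs with h1 | h1 <;> rw [h1] <;> linarith
      exact le_of_mul_le_mul_left this hv
    have := h.tail (fun p => if p ∈ cells T then s else 0) (fun p hp => by simp [hp])
      (fun p hp => by
        simp only [hp, if_true]
        rcases hvs with h1 | h1 <;> rw [h1] <;> linarith)
      (fun p => by
        split_ifs
        exacts [hs₀, h.tilt_pos.le])
      (μ / (1000 * v) * (1 / 1000 * μ * side T ^ 2))
    have e0 (ω : Ω) := sum_indicator_mul_eq_noiseSum (T := T) (μ := μ) s T fun i j => X i j ω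
    simp only [e0] at this
    refine this.trans (Real.exp_le_exp.2 (le_of_eq ?_))
    have e : ∀ p : Fin M × Fin N, (if p ∈ cells T then v else σ) *
        (if p ∈ cells T then s else 0) ^ 2 / 2 = if p ∈ cells T then v * s ^ 2 / 2 else 0 := by
      intro p
      split_ifs <;> simp
    simp only [e, Finset.sum_ite_mem, Finset.univ_inter, Finset.sum_const, nsmul_eq_mul,
      cells_card, hs2]
    field_simp
    ring
  have hpos : 0 < μ / (1000 * v) := by positivity
  have hsub : {ω | 1 / 1000 * μ * side T ^ 2 ≤ |noiseSum μ (fun i j => X i j ω) T T|} ⊆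
      {ω | μ / (1000 * v) * (1 / 1000 * μ * side T ^ 2)
        ≤ μ / (1000 * v) * noiseSum μ (fun i j => X i j ω) T T} ∪
      {ω | μ / (1000 * v) * (1 / 1000 * μ * side T ^ 2)
        ≤ -(μ / (1000 * v)) * noiseSum μ (fun i j => X i j ω) T T} := by
    intro ω hω
    rcases le_abs.1 (show 1 / 1000 * μ * side T ^ 2 ≤ |noiseSum μ (fun i j => X i j ω) T T| from hω)
      with h1 | h1
    · left
      exact mul_le_mul_of_nonneg_left h1 hpos.le
    · right
      rw [Set.mem_ofPred_eq, neg_mul, ← mul_neg]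
      exact mul_le_mul_of_nonneg_left h1 hpos.le
  refine (measureReal_mono hsub).trans ((measureReal_union_le _ _).trans ?_)
  have h1 := hsign _ (Or.inl rfl)
  have h2 := hsign _ (Or.inr rfl)
  linarith

/-- With tilt `l / side S` the exponent is `-(1 - σ/2) * l ^ 2`, minus the slack `μ * side T * l /
1000`, plus the excess variance `v - σ` on the overlap. By `hover` the slack absorbs the excess, and
`hσ` turns the main term into `1 + δ/4` times the logarithm in the penalty. -/
lemma PlantedModel.scan_noise (h : PlantedModel P X T μ v σ s₀) {δ : ℝ} (hδ : 0 < δ)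
    (hσ : 1 + δ / 4 ≤ (1 - σ / 2) * (2 + δ)) (hM : 0 < M) (hN : 0 < N)
    {S : Finset (Fin M) × Finset (Fin N)} (hS : 0 < side S)
    (htilt : penalty δ M N S.1.card S.2.card ≤ s₀ * side S)
    (hover : (v - σ) * penalty δ M N S.1.card S.2.card * overlap S T
      ≤ 1 / 500 * μ * side T * side S ^ 2) :
    P.real {ω | side S * (penalty δ M N S.1.card S.2.card + 1 / 1000 * μ * side T) ≤
        noiseSum μ (fun i j => X i j ω) T S} ≤
      Real.exp (-((1 + δ / 4) * (Real.log M + Real.log N))) *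
        (((M.choose S.1.card : ℝ))⁻¹ * ((N.choose S.2.card : ℝ))⁻¹) := by
  have hv := h.var_pos
  have hμ := h.mean_pos
  have hmM : S.1.card ≤ M := by simpa using Finset.card_le_univ S.1
  have hnN : S.2.card ≤ N := by simpa using Finset.card_le_univ S.2
  have hl2 := penalty_sq hδ hM hN hmM hnN
  have hl0 : 0 < penalty δ M N S.1.card S.2.card ∨ penalty δ M N S.1.card S.2.card = 0 :=
    (penalty_nonneg _ _ _ _ _).lt_or_eq.imp_right Eq.symm
  set l := penalty δ M N S.1.card S.2.card with hl
  have hlnn : 0 ≤ l := penalty_nonneg _ _ _ _ _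
  set s := l / side S with hs
  have hs0 : 0 ≤ s := div_nonneg hlnn hS.le
  have hss : s * side S = l := by rw [hs]; field_simp
  have := h.tail (fun p => if p ∈ cells S then s else 0)
    (fun p hp => by
      split_ifs
      exacts [hs0, le_rfl])
    (fun p hp => by
      have : 0 ≤ v * (if p ∈ cells S then s else 0) := by
        split_ifs
        exacts [mul_nonneg hv.le hs0, by simp]
      linarith)
    (fun p => by
      split_ifs
      exacts [(div_le_iff₀ hS).2 htilt, h.tilt_pos.le])
    (s * (side S * (l + 1 / 1000 * μ * side T)))
  have e0 (ω : Ω) := sum_indicator_mul_eq_noiseSum (T := T) (μ := μ) s S fun i j => X i j ω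
  simp only [e0] at this
  have e : ∀ p : Fin M × Fin N, (if p ∈ cells T then v else σ) *
      (if p ∈ cells S then s else 0) ^ 2 / 2 = (if p ∈ cells S then σ * s ^ 2 / 2 else 0) +
        if p ∈ cells S ∩ cells T then (v - σ) * s ^ 2 / 2 else 0 := by
    intro p
    by_cases h1 : p ∈ cells S <;> by_cases h2 : p ∈ cells T <;>
      simp [h1, h2]
    ring
  simp only [e, Finset.sum_add_distrib, Finset.sum_ite_mem, Finset.univ_inter, Finset.sum_const,
    nsmul_eq_mul, cells_card, cells_inter_card] at this
  refine (measureReal_mono ?_).trans (this.trans ?_)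
  · intro ω hω
    exact mul_le_mul_of_nonneg_left hω hs0
  · have hc1 : (0 : ℝ) < M.choose S.1.card := by exact_mod_cast Nat.choose_pos hmM
    have hc2 : (0 : ℝ) < N.choose S.2.card := by exact_mod_cast Nat.choose_pos hnN
    have hr : Real.exp (-((1 + δ / 4) * (Real.log M + Real.log N))) *
        (((M.choose S.1.card : ℝ))⁻¹ * ((N.choose S.2.card : ℝ))⁻¹) =
        Real.exp (-((1 + δ / 4) * (Real.log M + Real.log N)) - Real.log (M.choose S.1.card)
          - Real.log (N.choose S.2.card)) := by
      rw [Real.exp_sub, Real.exp_sub, Real.exp_log hc1, Real.exp_log hc2]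
      field_simp
    rw [hr, Real.exp_le_exp]
    have g1 := Real.log_natCast_nonneg (M.choose S.1.card)
    have g2 := Real.log_natCast_nonneg (N.choose S.2.card)
    have g3 := Real.log_natCast_nonneg M
    have g4 := Real.log_natCast_nonneg N
    have k1 : overlap S T * ((v - σ) * s ^ 2 / 2) ≤ 1 / 1000 * μ * side T * l := by
      have : s * s * ((v - σ) * overlap S T) * side S ≤ 1 / 500 * μ * side T * l * side S := by
        calc s * s * ((v - σ) * overlap S T) * side S
            = s * ((v - σ) * l * overlap S T) := by rw [← hss]; ring
          _ ≤ s * (1 / 500 * μ * side T * side S ^ 2) := by gcongr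
          _ = _ := by rw [← hss]; ring
      have := le_of_mul_le_mul_right this hS
      nlinarith
    have k2 : side S ^ 2 * (σ * s ^ 2 / 2) = σ / 2 * l ^ 2 := by rw [← hss]; ring
    have k3 : s * (side S * (l + 1 / 1000 * μ * side T)) = l ^ 2 + 1 / 1000 * μ * side T * l := by
      rw [← mul_assoc, hss]; ring
    have k4 : (1 + δ / 4) * (Real.log M + Real.log N + Real.log (M.choose S.1.card)
        + Real.log (N.choose S.2.card)) ≤ (1 - σ / 2) * l ^ 2 := by
      rw [hl2, ← mul_assoc]
      exact mul_le_mul_of_nonneg_right hσ (by positivity)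
    rw [k2, k3]
    nlinarith

lemma PlantedModel.swap_noise (h : PlantedModel P X T μ v σ s₀) {ℓr ℓc : ℝ}
    (hr0 : 0 ≤ ℓr) (hc0 : 0 ≤ ℓc)
    (hr : 26 * v * ℓr ≤ μ ^ 2 * T.2.card) (hc : 26 * v * ℓc ≤ μ ^ 2 * T.1.card)
    {S : Finset (Fin M) × Finset (Fin N)} (hS : 0 < side S) (hT : 0 < side T)
    (hnear : 4 / 5 * (side S * side T) < overlap S T) :
    P.real {ω | 4 / 5 * μ * (side S * side T - overlap S T) ≤
        noiseSum μ (fun i j => X i j ω) T S - noiseSum μ (fun i j => X i j ω) T T} ≤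
      Real.exp (-ℓr) ^ (symmDiff S.1 T.1).card * Real.exp (-ℓc) ^ (symmDiff S.2 T.2).card := by
  have hv := h.var_pos
  have hμ := h.mean_pos
  -- Close to the optimal tilt. The weights are `s` on `S \ T`, `-s` on `T \ S` and `0` on the
  -- intersection; `-s` is admissible because `v * s ≤ μ`.
  set s := μ / (3 * v) with hs
  have hs0 : 0 < s := by positivity
  have hvs : v * s = μ / 3 := by rw [hs]; field_simp
  have hs₀ : s ≤ s₀ := by
    have : v * s ≤ v * s₀ := by
      have := h.mean_le
      linarith
    exact le_of_mul_le_mul_left this hv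
  set c : Fin M × Fin N → ℝ := fun p =>
    (if p ∈ cells S then s else 0) - (if p ∈ cells T then s else 0) with hcdef
  have := h.tail c
    (fun p hp => by
      simp only [hcdef, hp, if_false, sub_zero]
      split_ifs
      exacts [hs0.le, le_rfl])
    (fun p hp => by
      simp only [hcdef, hp, if_true]
      split_ifs <;> simp <;> linarith)
    (fun p => by
      simp only [hcdef]
      have := h.tilt_pos
      split_ifs <;> linarith)
    (s * (4 / 5 * μ * (side S * side T - overlap S T)))
  have e0 (ω : Ω) := sum_indicator_mul_eq_noiseSum (T := T) (μ := μ) s S fun i j => X i j ω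
  have e1 (ω : Ω) := sum_indicator_mul_eq_noiseSum (T := T) (μ := μ) s T fun i j => X i j ω
  simp only [hcdef, sub_mul, Finset.sum_sub_distrib, e0, e1, ← mul_sub] at this
  refine (measureReal_mono ?_).trans (this.trans ?_)
  · intro ω hω
    exact mul_le_mul_of_nonneg_left hω hs0.le
  · have e : ∀ p : Fin M × Fin N, (if p ∈ cells T then v else σ) *
        ((if p ∈ cells S then s else 0) - (if p ∈ cells T then s else 0)) ^ 2 / 2 ≤
        (if p ∈ cells S then v * s ^ 2 / 2 else 0) + (if p ∈ cells T then v * s ^ 2 / 2 else 0)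
          - 2 * (if p ∈ cells S ∩ cells T then v * s ^ 2 / 2 else 0) := by
      intro p
      have := mul_le_mul_of_nonneg_right h.le_var (sq_nonneg s)
      by_cases h1 : p ∈ cells S <;> by_cases h2 : p ∈ cells T <;>
        simp [h1, h2] <;> linarith
    have e' := Finset.sum_le_sum fun p (_ : p ∈ Finset.univ) => e p
    simp only [Finset.sum_sub_distrib, Finset.sum_add_distrib, ← Finset.mul_sum,
      Finset.sum_ite_mem, Finset.univ_inter, Finset.sum_const,
      nsmul_eq_mul, cells_card, cells_inter_card] at e'
    rw [← Real.exp_nat_mul, ← Real.exp_nat_mul, ← Real.exp_add, Real.exp_le_exp,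
      card_symmDiff_cast, card_symmDiff_cast]
    have hk := symmDiff_le_of_overlap hS hT (overlap_le_left S T) (overlap_le_right S T) hnear
    obtain ⟨u, w, hu, hw, hu2, hw2, huw, ha, hc'⟩ := factors_of_near hS hT hnear
    have hcard : ∀ {n : ℕ} (A B : Finset (Fin n)), ((A ∩ B).card : ℝ) ≤ A.card ∧
        ((A ∩ B).card : ℝ) ≤ B.card := fun A B =>
      ⟨by exact_mod_cast Finset.card_le_card Finset.inter_subset_left,
        by exact_mod_cast Finset.card_le_card Finset.inter_subset_right⟩
    obtain ⟨a1, a2⟩ := hcard S.1 T.1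
    obtain ⟨c1, c2⟩ := hcard S.2 T.2
    have hdef := overlap_deficit (by linarith) a1 a2 hu hu2 (by linarith) c1 c2 hw hw2 ha hc'
    rw [← huw] at hdef
    change _ ≤ side S * side T - overlap S T at hdef
    set G := side S * side T - overlap S T with hG
    set d1 : ℝ := (S.1.card : ℝ) + T.1.card - 2 * (S.1 ∩ T.1).card
    set d2 : ℝ := (S.2.card : ℝ) + T.2.card - 2 * (S.2 ∩ T.2).card
    have hd1 : 0 ≤ d1 := by simp only [d1]; linarith
    have hd2 : 0 ≤ d2 := by simp only [d2]; linarith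
    have hvs2 : 0 ≤ v * s ^ 2 / 2 := by positivity
    have f1 : (side S ^ 2 + side T ^ 2 - 2 * overlap S T) * (v * s ^ 2 / 2)
        ≤ 9 / 4 * G * (v * s ^ 2 / 2) := mul_le_mul_of_nonneg_right hk hvs2
    have f2 : v * s ^ 2 = μ ^ 2 / v / 9 := by rw [hs]; field_simp; norm_num
    have f3 : s * μ = μ ^ 2 / v / 3 := by rw [hs]; field_simp
    set R := μ ^ 2 / v with hR
    have hR0 : 0 < R := by positivity
    have r1 : 26 * ℓr ≤ R * T.2.card := by
      rw [hR, div_mul_eq_mul_div, le_div_iff₀ hv]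
      linarith
    have r2 : 26 * ℓc ≤ R * T.1.card := by
      rw [hR, div_mul_eq_mul_div, le_div_iff₀ hv]
      linarith
    have m1 := mul_le_mul_of_nonneg_left hdef hR0.le
    have m2 := mul_le_mul_of_nonneg_left r1 hd1
    have m3 := mul_le_mul_of_nonneg_left r2 hd2
    have m4 := mul_nonneg hd1 hr0
    have m5 := mul_nonneg hd2 hc0
    have f4 : s * (4 / 5 * μ * G) = 4 / 5 * (R / 3) * G := by rw [← f3]; ring
    rw [f4]
    rw [f2] at f1 e'
    -- Here `17/120 = 4/15 - 1/8` is what the linear term retains after the variance term, and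
    -- `17/120 * 64/225 * 26 > 1` is why the factor `26` suffices.
    have f5 : 17 / 120 * (64 / 225) * (26 * (d1 * ℓr + d2 * ℓc)) ≤ 17 / 120 * (R * G) := by
      linarith
    linarith

/-- Non-asymptotic lower bound on the probability of exact recovery. -/
theorem PlantedModel.recovery (h : PlantedModel P X T μ v σ s₀) {δ : ℝ} (hδ : 0 < δ)
    (hσ : 1 + δ / 4 ≤ (1 - σ / 2) * (2 + δ)) {mlow nlow : ℕ}
    (hmlow : 0 < mlow) (hnlow : 0 < nlow)
    (hTm : mlow ≤ T.1.card) (hTn : nlow ≤ T.2.card) (hM : 4 * T.1.card ≤ M) (hN : 4 * T.2.card ≤ N)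
    (hl : 51 / 10 * penalty δ M N T.1.card T.2.card ≤ μ * side T)
    (hscan : ∀ S ∈ scanRange M N mlow nlow, penalty δ M N S.1.card S.2.card ≤ s₀ * side S ∧
      (v - σ) * penalty δ M N S.1.card S.2.card * overlap S T ≤ 1 / 500 * μ * side T * side S ^ 2)
    {ℓr ℓc : ℝ} (hr0 : 0 ≤ ℓr) (hc0 : 0 ≤ ℓc)
    (hr : 26 * v * ℓr ≤ μ ^ 2 * T.2.card) (hc : 26 * v * ℓc ≤ μ ^ 2 * T.1.card) :
    1 - (2 * Real.exp (-(μ ^ 2 * side T ^ 2 / (2000000 * v))) +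
      Real.exp (-((1 + δ / 4) * (Real.log M + Real.log N))) * ((M + 1) * (N + 1)) +
      ((1 + Real.exp (-ℓr)) ^ M * (1 + Real.exp (-ℓc)) ^ N - 1)) ≤
    P.real {ω | scanArgmax δ mlow nlow (fun i j => X i j ω) = {T}} := by
  classical
  have hT : 0 < side T := side_pos (by omega) (by omega)
  have hpos : ∀ S ∈ scanRange M N mlow nlow, 0 < side S := fun S hS =>
    side_pos (by have := hS.1; omega) (by have := hS.2; omega)
  set A := {ω | 1 / 1000 * μ * side T ^ 2 ≤ |noiseSum μ (fun i j => X i j ω) T T|} with hA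
  set F1 : Finset (Finset (Fin M) × Finset (Fin N)) :=
    Finset.univ.filter (· ∈ scanRange M N mlow nlow) with hF1
  set F2 : Finset (Finset (Fin M) × Finset (Fin N)) :=
    Finset.univ.filter fun S => S ∈ scanRange M N mlow nlow ∧ S ≠ T ∧
      4 / 5 * (side S * side T) < overlap S T with hF2
  set B : Finset (Fin M) × Finset (Fin N) → Set Ω := fun S =>
    {ω | side S * (penalty δ M N S.1.card S.2.card + 1 / 1000 * μ * side T) ≤
        noiseSum μ (fun i j => X i j ω) T S} with hB
  set D : Finset (Fin M) × Finset (Fin N) → Set Ω := fun S =>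
    {ω | 4 / 5 * μ * (side S * side T - overlap S T) ≤
        noiseSum μ (fun i j => X i j ω) T S - noiseSum μ (fun i j => X i j ω) T T} with hD
  set G := {ω | scanArgmax δ mlow nlow (fun i j => X i j ω) = {T}} with hG
  have hcover : (Set.univ : Set Ω) ⊆ G ∪ (A ∪ (⋃ S ∈ F1, B S) ∪ ⋃ S ∈ F2, D S) := by
    intro ω _
    by_contra hω
    simp only [Set.mem_union, Set.mem_iUnion, not_or, not_exists] at hω
    obtain ⟨hωG, ⟨hωA, hωB⟩, hωD⟩ := hω
    refine hωG (scanArgmax_eq_singleton hδ h.mean_pos hmlow hnlow hTm hTn hM hN hl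
      (not_le.1 hωA).le (fun S hS => (not_le.1 (hωB S (by simp [hF1, hS]))).le)
      fun S hS hne hov => not_le.1 (hωD S (by simp [hF2, hS, hne, hov])))
  have hA' := h.planted_noise
  have hB' : P.real (⋃ S ∈ F1, B S) ≤
      Real.exp (-((1 + δ / 4) * (Real.log M + Real.log N))) * ((M + 1) * (N + 1)) := by
    refine (measureReal_biUnion_finset_le F1 B).trans ?_
    calc ∑ S ∈ F1, P.real (B S) ≤ ∑ S ∈ F1,
          Real.exp (-((1 + δ / 4) * (Real.log M + Real.log N))) *
            (((M.choose S.1.card : ℝ))⁻¹ * ((N.choose S.2.card : ℝ))⁻¹) := by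
          refine Finset.sum_le_sum fun S hS => ?_
          have hS' : S ∈ scanRange M N mlow nlow := by simpa [hF1] using hS
          exact h.scan_noise hδ hσ (by omega) (by omega) (hpos S hS') (hscan S hS').1 (hscan S hS').2
      _ ≤ ∑ S : Finset (Fin M) × Finset (Fin N),
          Real.exp (-((1 + δ / 4) * (Real.log M + Real.log N))) *
            (((M.choose S.1.card : ℝ))⁻¹ * ((N.choose S.2.card : ℝ))⁻¹) :=
          Finset.sum_le_sum_of_subset_of_nonneg (Finset.subset_univ _) fun S _ _ => by positivity
      _ = _ := by
          rw [← Finset.mul_sum, Fintype.sum_prod_type, ← sum_inv_choose_card M,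
            ← sum_inv_choose_card N, Finset.sum_mul_sum]
  have hD' : P.real (⋃ S ∈ F2, D S) ≤
      (1 + Real.exp (-ℓr)) ^ M * (1 + Real.exp (-ℓc)) ^ N - 1 := by
    set f : Finset (Fin M) × Finset (Fin N) → ℝ := fun S =>
      Real.exp (-ℓr) ^ (symmDiff S.1 T.1).card * Real.exp (-ℓc) ^ (symmDiff S.2 T.2).card with hf
    have hsum : ∑ S, f S = (1 + Real.exp (-ℓr)) ^ M * (1 + Real.exp (-ℓc)) ^ N := by
      have e1 := sum_pow_card_symmDiff T.1 (Real.exp (-ℓr))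
      have e2 := sum_pow_card_symmDiff T.2 (Real.exp (-ℓc))
      rw [Fintype.card_fin] at e1 e2
      rw [← e1, ← e2, Finset.sum_mul_sum, Fintype.sum_prod_type]
    -- The near submatrices exclude `T`, so its term is subtracted from the full sum.
    have hfT : f T = 1 := by simp [hf]
    rw [← hsum, ← hfT, ← Finset.sum_erase_eq_sub (Finset.mem_univ T)]
    refine (measureReal_biUnion_finset_le F2 D).trans ?_
    calc ∑ S ∈ F2, P.real (D S) ≤ ∑ S ∈ F2, f S := by
          refine Finset.sum_le_sum fun S hS => ?_
          have hS' : S ∈ scanRange M N mlow nlow ∧ S ≠ T ∧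
            4 / 5 * (side S * side T) < overlap S T := by simpa [hF2] using hS
          exact h.swap_noise hr0 hc0 hr hc (hpos S hS'.1) hT hS'.2.2
      _ ≤ _ := by
          refine Finset.sum_le_sum_of_subset_of_nonneg (fun S hS => ?_) fun S _ _ => by positivity
          have hS' : S ∈ scanRange M N mlow nlow ∧ S ≠ T ∧
            4 / 5 * (side S * side T) < overlap S T := by simpa [hF2] using hS
          simp [hS'.2.1]
  have h1 : (1 : ℝ) ≤ P.real G + P.real (A ∪ (⋃ S ∈ F1, B S) ∪ ⋃ S ∈ F2, D S) := by
    rw [← probReal_univ (μ := P)]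
    exact (measureReal_mono hcover).trans (measureReal_union_le _ _)
  have h2 := measureReal_union_le (μ := P) (A ∪ ⋃ S ∈ F1, B S) (⋃ S ∈ F2, D S)
  have h3 := measureReal_union_le (μ := P) A (⋃ S ∈ F1, B S)
  linarith

end Tail

/-! ### Numerical constants and the signal threshold. -/

/-- If `C ≤ 26/5`, then `C / (C - 1) ≥ 26/21`, and the right side of the equation exceeds `2 * (1.37
+ 1.30) = 5.34`, a contradiction. -/
lemma threshold_constant_gt {C : ℝ} (hC : 1 < C)
    (hC_eq : C = 2 * ((C / (C - 1)) ^ (1.5 : ℝ) + (C / (C - 1)) ^ (1.25 : ℝ))) : 26 / 5 < C := by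
  by_contra! h
  set r := C / (C - 1) with hr
  have hr1 : 26 / 21 ≤ r := by
    rw [hr, le_div_iff₀ (by linarith)]
    linarith
  have hr0 : 0 ≤ r := by linarith
  have h1 : (137 / 100 : ℝ) < r ^ (1.5 : ℝ) := by
    refine lt_of_pow_lt_pow_left₀ 2 (by positivity) ?_
    rw [← Real.rpow_natCast (r ^ (1.5 : ℝ)), ← Real.rpow_mul hr0,
      show (1.5 : ℝ) * ((2 : ℕ) : ℝ) = ((3 : ℕ) : ℝ) by norm_num, Real.rpow_natCast]
    calc (137 / 100 : ℝ) ^ 2 < (26 / 21) ^ 3 := by norm_num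
      _ ≤ r ^ 3 := by gcongr
  have h2 : (13 / 10 : ℝ) < r ^ (1.25 : ℝ) := by
    refine lt_of_pow_lt_pow_left₀ 4 (by positivity) ?_
    rw [← Real.rpow_natCast (r ^ (1.25 : ℝ)), ← Real.rpow_mul hr0,
      show (1.25 : ℝ) * ((4 : ℕ) : ℝ) = ((5 : ℕ) : ℝ) by norm_num, Real.rpow_natCast]
    calc (13 / 10 : ℝ) ^ 4 < (26 / 21) ^ 5 := by norm_num
      _ ≤ r ^ 5 := by gcongr
  linarith

/-- The penalty is small compared with the side of a submatrix which is not too thin. -/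
lemma penalty_le_mul_sqrt {δ τ η : ℝ} (hδ : 0 < δ) (hη : 0 < η)
    (hτη : 4 * (2 + δ) * τ ≤ η ^ 2) {M N m n : ℕ} (hM : 0 < M) (hN : 0 < N)
    (hm0 : 0 < m) (hn0 : 0 < n) (hm : m ≤ M) (hn : n ≤ N) (hlM : Real.log M ≤ τ * n)
    (hlN : Real.log N ≤ τ * m) :
    penalty δ M N m n ≤ η * Real.sqrt ((m : ℝ) * n) := by
  refine le_of_sq_le_sq ?_ (by positivity)
  rw [penalty_sq hδ hM hN hm hn, mul_pow, Real.sq_sqrt (by positivity)]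
  have hch : ∀ K k : ℕ, k ≤ K → Real.log (K.choose k) ≤ k * Real.log K := by
    intro K k hk
    rw [← Real.log_pow]
    exact Real.log_le_log (by exact_mod_cast Nat.choose_pos hk)
      (by exact_mod_cast Nat.choose_le_pow K k)
  have h1 := hch M m hm
  have h2 := hch N n hn
  have hm1 : (1 : ℝ) ≤ m := by exact_mod_cast hm0
  have hn1 : (1 : ℝ) ≤ n := by exact_mod_cast hn0
  have h3 : Real.log M ≤ m * Real.log M :=
    le_mul_of_one_le_left (Real.log_natCast_nonneg M) hm1
  have h4 : Real.log N ≤ n * Real.log N :=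
    le_mul_of_one_le_left (Real.log_natCast_nonneg N) hn1
  have h5 : m * Real.log M ≤ m * (τ * n) := by gcongr
  have h6 : n * Real.log N ≤ n * (τ * m) := by gcongr
  calc (2 + δ) * (Real.log M + Real.log N + Real.log (M.choose m) + Real.log (N.choose n))
      ≤ (2 + δ) * (4 * (τ * (m * n))) := by
        refine mul_le_mul_of_nonneg_left ?_ (by linarith)
        linarith
    _ = 4 * (2 + δ) * τ * (m * n) := by ring
    _ ≤ η ^ 2 * (m * n) := by gcongr

lemma HasLaw.integrable_comp {Ω : Type*} [MeasurableSpace Ω] {P : Measure Ω} {Y : Ω → ℝ}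
    {ρ : Measure ℝ} (h : HasLaw Y ρ P) {f : ℝ → ℝ} (hf : Integrable f ρ) :
    Integrable (fun ω => f (Y ω)) P := by
  rw [← h.map_eq] at hf
  exact (integrable_map_measure hf.aestronglyMeasurable h.aemeasurable).1 hf

lemma HasLaw.integral_comp_eq {Ω : Type*} [MeasurableSpace Ω] {P : Measure Ω} {Y : Ω → ℝ}
    {ρ : Measure ℝ} (h : HasLaw Y ρ P) {f : ℝ → ℝ} (hf : Integrable f ρ) :
    ∫ ω, f (Y ω) ∂P = ∫ x, f x ∂ρ :=
  h.integral_comp hf.aestronglyMeasurable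

/-- The error term of exact recovery. -/
noncomputable def recoveryError (δ : ℝ) (M m n : ℕ) : ℝ :=
  2 * Real.exp (-(Real.log m / 100000)) + 4 * Real.exp (-(δ / 4 * Real.log M)) +
    (Real.exp (2 / (m : ℝ) + 2 / (n : ℝ)) - 1)

/-- The exponential is `1 / ((M - m) * m)`; use `1 + x ≤ exp x` and `M ≤ 2 * (M - m)`. -/
lemma one_add_exp_pow_le {M m : ℕ} (hm : 0 < m) (hM : 4 * m ≤ M) :
    (1 + Real.exp (-(Real.log ((M : ℝ) - m) + Real.log m))) ^ M ≤ Real.exp (2 / (m : ℝ)) := by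
  have hm' : (0 : ℝ) < m := by exact_mod_cast hm
  have hM' : 4 * (m : ℝ) ≤ M := by exact_mod_cast hM
  have hMm : (0 : ℝ) < (M : ℝ) - m := by linarith
  have e : Real.exp (-(Real.log ((M : ℝ) - m) + Real.log m)) = (((M : ℝ) - m) * m)⁻¹ := by
    rw [Real.exp_neg, Real.exp_add, Real.exp_log hMm, Real.exp_log hm']
  rw [e]
  calc (1 + (((M : ℝ) - m) * m)⁻¹) ^ M ≤ Real.exp ((((M : ℝ) - m) * m)⁻¹) ^ M := by
        gcongr
        rw [add_comm]
        exact Real.add_one_le_exp _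
    _ = Real.exp (M * (((M : ℝ) - m) * m)⁻¹) := by rw [← Real.exp_nat_mul]
    _ ≤ _ := by
        rw [Real.exp_le_exp, ← div_eq_mul_inv, div_le_div_iff₀ (by positivity) hm']
        nlinarith

lemma exp_neg_mul_succ_le {δ : ℝ} (hδ : 0 < δ) {M N : ℕ} (hM : 0 < M) (hN : 0 < N) :
    Real.exp (-((1 + δ / 4) * (Real.log M + Real.log N))) * ((M + 1) * (N + 1)) ≤
      4 * Real.exp (-(δ / 4 * Real.log M)) := by
  have hM' : (1 : ℝ) ≤ M := by exact_mod_cast hM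
  have hN' : (1 : ℝ) ≤ N := by exact_mod_cast hN
  have hlN := Real.log_natCast_nonneg N
  have h1 : ((M : ℝ) + 1) * (N + 1) ≤ 4 * (Real.exp (Real.log M) * Real.exp (Real.log N)) := by
    rw [Real.exp_log (by linarith), Real.exp_log (by linarith)]
    nlinarith
  calc _ ≤ Real.exp (-((1 + δ / 4) * (Real.log M + Real.log N))) *
        (4 * (Real.exp (Real.log M) * Real.exp (Real.log N))) := by gcongr
    _ = 4 * Real.exp (-(δ / 4 * Real.log M) - δ / 4 * Real.log N) := by
        rw [mul_left_comm, ← Real.exp_add, ← Real.exp_add]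
        ring_nf
    _ ≤ _ := by
        gcongr
        have : 0 ≤ δ / 4 * Real.log N := by positivity
        linarith

/-- The signal dominates the logarithmic terms of the threshold. -/
lemma mul_le_sq_signal {ε c₀ K τ θ μ v ℓ n : ℝ} (hε : 0 < ε) (hε1 : ε ≤ 1 / 100)
    (hc₀ : 0 < c₀) (hK : 1 + ε ≤ K) (hτc : 52 * K * τ ≤ c₀ ^ 2)
    (hμv : ((1 - ε) * θ ≤ μ ∧ v = 1 + ε) ∨ (c₀ ≤ μ ∧ v = K))
    (h0 : 0 ≤ ℓ) (hn : 1 ≤ n) (h1 : ℓ ≤ 2 * τ * n) (h2 : 26 / 5 * Real.sqrt (ℓ / n) ≤ θ) :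
    26 * v * ℓ ≤ μ ^ 2 * n := by
  have hn' : 0 < n := by linarith
  rcases hμv with ⟨h3, h4⟩ | ⟨h3, h4⟩
  -- Near `θ = 0` the numbers fit because `(26/5) ^ 2 * (99/100) ^ 2 > 26 * 101/100`.
  · have h5 : (26 / 5) ^ 2 * (ℓ / n) ≤ θ ^ 2 := by
      rw [← Real.sq_sqrt (show 0 ≤ ℓ / n by positivity), ← mul_pow]
      gcongr
    have hθ0 : 0 ≤ θ := le_trans (by positivity) h2
    have h6 : (99 / 100 * θ) ^ 2 ≤ μ ^ 2 := by
      have : 99 / 100 * θ ≤ (1 - ε) * θ := mul_le_mul_of_nonneg_right (by linarith) hθ0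
      exact pow_le_pow_left₀ (by positivity) (this.trans h3) 2
    have h7 : (26 / 5) ^ 2 * ℓ ≤ θ ^ 2 * n := by
      rwa [← mul_div_assoc, div_le_iff₀ hn'] at h5
    have h8 := mul_le_mul_of_nonneg_right h6 hn'.le
    have h9 : v * ℓ ≤ 101 / 100 * ℓ := mul_le_mul_of_nonneg_right (by linarith) h0
    linarith
  · have h5 : c₀ ^ 2 ≤ μ ^ 2 := pow_le_pow_left₀ hc₀.le h3 2
    have hK0 : 0 < K := by linarith
    rw [h4]
    calc 26 * K * ℓ ≤ 26 * K * (2 * τ * n) := by gcongr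
      _ = 52 * K * τ * n := by ring
      _ ≤ c₀ ^ 2 * n := mul_le_mul_of_nonneg_right hτc hn'.le
      _ ≤ μ ^ 2 * n := mul_le_mul_of_nonneg_right h5 hn'.le

/-- The signal dominates the penalty term of the threshold. -/
lemma penalty_le_signal {ε c₀ K η θ μ v l s : ℝ} (hε : 0 < ε) (hε1 : ε ≤ 1 / 100)
    (hK : 1 + ε ≤ K) (hη : 0 < η) (hηc : 500 * K * η ≤ c₀)
    (hμv : ((1 - ε) * θ ≤ μ ∧ v = 1 + ε) ∨ (c₀ ≤ μ ∧ v = K))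
    (hl : 0 ≤ l) (hs : 0 < s) (hls : l ≤ η * s) (h : 26 / 5 * (l / s) ≤ θ) :
    51 / 10 * l ≤ μ * s := by
  rcases hμv with ⟨h3, -⟩ | ⟨h3, -⟩
  · have hθ0 : 0 ≤ θ := le_trans (by positivity) h
    rw [← mul_div_assoc, div_le_iff₀ hs] at h
    have h4 : 99 / 100 * θ ≤ (1 - ε) * θ := mul_le_mul_of_nonneg_right (by linarith) hθ0
    have h5 := mul_le_mul_of_nonneg_right (h4.trans h3) hs.le
    linarith
  · have h4 : η ≤ K * η := le_mul_of_one_le_left hη.le (by linarith)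
    have h6 := mul_le_mul_of_nonneg_right (show 51 / 10 * η ≤ μ by linarith) hs.le
    linarith

/-- The excess variance of the overlap is dominated by the signal. -/
lemma excess_variance_le_signal {ε c₀ K η θ μ v l s t o : ℝ} (hε : 0 < ε)
    (hK : 1 + ε ≤ K) (hη : 0 < η) (hηc : 500 * K * η ≤ c₀) (hμ : 0 < μ)
    (hμv : ((1 - ε) * θ ≤ μ ∧ v = 1 + ε) ∨ (c₀ ≤ μ ∧ v = K))
    (hl : 0 ≤ l) (hs : 0 < s) (ht : 0 < t) (ho : 0 ≤ o) (hls : l ≤ η * s) (hos : o ≤ s ^ 2)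
    (hot : o ≤ t ^ 2) : (v - (1 + ε)) * l * o ≤ 1 / 500 * μ * t * s ^ 2 := by
  rcases hμv with ⟨-, h4⟩ | ⟨h3, h4⟩
  · rw [h4, sub_self, zero_mul, zero_mul]
    positivity
  · have hov : o ≤ s * t := by
      refine le_of_sq_le_sq ?_ (by positivity)
      rw [sq, mul_pow]
      exact mul_le_mul hos hot ho (by positivity)
    have hK0 : 0 < K := by linarith
    rw [h4]
    calc (K - (1 + ε)) * l * o ≤ K * (η * s) * (s * t) := by
          gcongr
          linarith
      _ = K * η * (t * s ^ 2) := by ring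
      _ ≤ 1 / 500 * μ * (t * s ^ 2) :=
          mul_le_mul_of_nonneg_right (by linarith) (by positivity)
      _ = _ := by ring

set_option maxHeartbeats 1000000 in
/-- Exact recovery for fixed dimensions, with an explicit error term. -/
theorem one_sub_recoveryError_le {ν : Measure ℝ} {δ ε s₀ c₀ K η τ C : ℝ}
    (hδ : 0 < δ) (hε : 0 < ε) (hε1 : ε ≤ 1 / 100) (hεδ : ε * (2 * (2 + δ)) ≤ δ)
    (hs₀ : 0 < s₀) (hc₀ : 0 < c₀) (hK : 1 + ε ≤ K) (hη : 0 < η) (hηs : η ≤ s₀)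
    (hηc : 500 * K * η ≤ c₀) (hτη : 4 * (2 + δ) * τ ≤ η ^ 2)
    (hτc : 52 * K * τ ≤ c₀ ^ 2) (hC : 26 / 5 ≤ C)
    (hν : ∀ s, 0 ≤ s → s ≤ s₀ → Integrable (fun x => Real.exp (s * x)) ν ∧
        ∫ x, Real.exp (s * x) ∂ν ≤ Real.exp ((1 + ε) * s ^ 2 / 2))
    {θ : ℝ} {μ v : ℝ} (hμv : ((1 - ε) * θ ≤ μ ∧ v = 1 + ε) ∨ (c₀ ≤ μ ∧ v = K))
    (hμ : 0 < μ) (hμs : μ ≤ v * s₀)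
    (hνθ : ∀ s, -μ ≤ v * s → s ≤ s₀ →
          Integrable (fun x => Real.exp (s * (x - μ))) (expFamily ν θ) ∧
          ∫ x, Real.exp (s * (x - μ)) ∂(expFamily ν θ) ≤ Real.exp (v * s ^ 2 / 2))
    {M N mlow nlow : ℕ} (hmlow : 0 < mlow) (hnlow : 0 < nlow)
    {I : Finset (Fin M)} {J : Finset (Fin N)} (hI : mlow ≤ I.card) (hJ : nlow ≤ J.card)
    (hM : 4 * I.card ≤ M) (hN : 4 * J.card ≤ N)
    (hlM : Real.log M ≤ τ * nlow) (hlN : Real.log N ≤ τ * mlow)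
    (hθ : thetaOne C δ M N I.card J.card ≤ θ)
    {Ω : Type*} [MeasurableSpace Ω] {P : Measure Ω} [IsProbabilityMeasure P]
    {X : Fin M → Fin N → Ω → ℝ} (hind : iIndepFun (fun p : Fin M × Fin N => X p.1 p.2) P)
    (hin : ∀ i j, i ∈ I ∧ j ∈ J → HasLaw (X i j) (expFamily ν θ) P)
    (hout : ∀ i j, ¬ (i ∈ I ∧ j ∈ J) → HasLaw (X i j) ν P) :
    1 - recoveryError δ M I.card J.card ≤
      P.real {ω | scanArgmax δ mlow nlow (fun i j => X i j ω) = {(I, J)}} := by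
  have hmem : ∀ p : Fin M × Fin N, p ∈ cells (I, J) ↔ p.1 ∈ I ∧ p.2 ∈ J := fun p => by
    simp [cells]
  have hσv : 1 + ε ≤ v := by rcases hμv with ⟨-, h⟩ | ⟨-, h⟩ <;> rw [h]; exact hK
  have hmodel : PlantedModel P X (I, J) μ v (1 + ε) s₀ :=
    { indep := hind
      meas := fun p => by
        by_cases hp : p.1 ∈ I ∧ p.2 ∈ J
        exacts [(hin _ _ hp).aemeasurable, (hout _ _ hp).aemeasurable]
      out := fun p hp s h0 h1 => by
        have hl := hout p.1 p.2 (fun h => hp ((hmem p).2 h))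
        have := hν s h0 h1
        exact ⟨HasLaw.integrable_comp hl this.1, (HasLaw.integral_comp_eq hl this.1).trans_le this.2⟩
      mem := fun p hp s h0 h1 => by
        have hl := hin p.1 p.2 ((hmem p).1 hp)
        have := hνθ s h0 h1
        exact ⟨HasLaw.integrable_comp hl this.1, (HasLaw.integral_comp_eq hl this.1).trans_le this.2⟩
      mean_pos := hμ
      tilt_pos := hs₀
      one_le := by linarith
      le_var := hσv
      mean_le := hμs }
  have hm0 : 0 < I.card := by omega
  have hn0 : 0 < J.card := by omega
  have hM0 : 0 < M := by omega
  have hN0 : 0 < N := by omega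
  have hm1 : (1 : ℝ) ≤ I.card := by exact_mod_cast hm0
  have hn1 : (1 : ℝ) ≤ J.card := by exact_mod_cast hn0
  have hM4 : 4 * (I.card : ℝ) ≤ M := by exact_mod_cast hM
  have hN4 : 4 * (J.card : ℝ) ≤ N := by exact_mod_cast hN
  have hT : 0 < side (I, J) := side_pos hm0 hn0
  have hτ0 : 0 ≤ τ := by
    have h1 : (0 : ℝ) < nlow := by exact_mod_cast hnlow
    have := (Real.log_natCast_nonneg M).trans hlM
    exact nonneg_of_mul_nonneg_left this h1
  have hpen : ∀ S ∈ scanRange M N mlow nlow,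
      penalty δ M N S.1.card S.2.card ≤ η * side S := by
    intro S hS
    have h1 : (mlow : ℝ) ≤ S.1.card := by exact_mod_cast hS.1
    have h2 : (nlow : ℝ) ≤ S.2.card := by exact_mod_cast hS.2
    exact penalty_le_mul_sqrt hδ hη hτη hM0 hN0 (hmlow.trans_le hS.1) (hnlow.trans_le hS.2)
      (by simpa using Finset.card_le_univ S.1) (by simpa using Finset.card_le_univ S.2)
      (hlM.trans (by gcongr)) (hlN.trans (by gcongr))
  have hTr : (I, J) ∈ scanRange M N mlow nlow := ⟨hI, hJ⟩
  set ℓr := Real.log ((M : ℝ) - (I.card : ℝ)) + Real.log (I.card : ℝ) with hℓr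
  set ℓc := Real.log ((N : ℝ) - (J.card : ℝ)) + Real.log (J.card : ℝ) with hℓc
  have hlm0 : 0 ≤ Real.log (I.card : ℝ) := Real.log_natCast_nonneg _
  have hln0 : 0 ≤ Real.log (J.card : ℝ) := Real.log_natCast_nonneg _
  have hr0 : Real.log (I.card : ℝ) ≤ ℓr := by
    have := Real.log_nonneg (x := (M : ℝ) - (I.card : ℝ)) (by linarith)
    linarith
  have hc0 : Real.log (J.card : ℝ) ≤ ℓc := by
    have := Real.log_nonneg (x := (N : ℝ) - (J.card : ℝ)) (by linarith)
    linarith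
  have hr2 : ℓr ≤ 2 * τ * J.card := by
    have h1 := Real.log_le_log (x := (M : ℝ) - (I.card : ℝ)) (y := M) (by linarith) (by linarith)
    have h2 := Real.log_le_log (x := (I.card : ℝ)) (y := M) (by linarith) (by linarith)
    have h3 : (nlow : ℝ) ≤ J.card := by exact_mod_cast hJ
    have h4 := mul_le_mul_of_nonneg_left h3 hτ0
    linarith
  have hc2 : ℓc ≤ 2 * τ * I.card := by
    have h1 := Real.log_le_log (x := (N : ℝ) - (J.card : ℝ)) (y := N) (by linarith) (by linarith)
    have h2 := Real.log_le_log (x := (J.card : ℝ)) (y := N) (by linarith) (by linarith)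
    have h3 : (mlow : ℝ) ≤ I.card := by exact_mod_cast hI
    have h4 := mul_le_mul_of_nonneg_left h3 hτ0
    linarith
  have hθsplit : ∀ y, 0 ≤ y → C * y ≤ θ → 26 / 5 * y ≤ θ := fun y h0 h =>
    (mul_le_mul_of_nonneg_right hC h0).trans h
  have hC0 : 0 ≤ C := by linarith
  have hθ1 : 26 / 5 * Real.sqrt (ℓr / J.card) ≤ θ := hθsplit _ (Real.sqrt_nonneg _)
    ((mul_le_mul_of_nonneg_left (le_max_left _ _) hC0).trans hθ)
  have hθ2 : 26 / 5 * Real.sqrt (ℓc / I.card) ≤ θ := hθsplit _ (Real.sqrt_nonneg _)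
    ((mul_le_mul_of_nonneg_left ((le_max_left _ _).trans (le_max_right _ _)) hC0).trans hθ)
  have hθ3 : 26 / 5 * (penalty δ M N I.card J.card / side (I, J)) ≤ θ :=
    hθsplit _ (div_nonneg (penalty_nonneg _ _ _ _ _) hT.le)
      ((mul_le_mul_of_nonneg_left ((le_max_right _ _).trans (le_max_right _ _)) hC0).trans hθ)
  have hr := mul_le_sq_signal hε hε1 hc₀ hK hτc hμv (hlm0.trans hr0) hn1 hr2 hθ1
  have hc := mul_le_sq_signal hε hε1 hc₀ hK hτc hμv (hln0.trans hc0) hm1 hc2 hθ2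
  have hl : 51 / 10 * penalty δ M N I.card J.card ≤ μ * side (I, J) :=
    penalty_le_signal hε hε1 hK hη hηc hμv (penalty_nonneg _ _ _ _ _) hT (hpen _ hTr) hθ3
  have hscan : ∀ S ∈ scanRange M N mlow nlow, penalty δ M N S.1.card S.2.card ≤ s₀ * side S ∧
      (v - (1 + ε)) * penalty δ M N S.1.card S.2.card * overlap S (I, J)
        ≤ 1 / 500 * μ * side (I, J) * side S ^ 2 := by
    intro S hS
    have hS0 : 0 < side S := side_pos (hmlow.trans_le hS.1) (hnlow.trans_le hS.2)
    exact ⟨(hpen S hS).trans (mul_le_mul_of_nonneg_right hηs hS0.le),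
      excess_variance_le_signal hε hK hη hηc hμ hμv (penalty_nonneg _ _ _ _ _) hS0 hT
        (overlap_nonneg _ _) (hpen S hS) (overlap_le_left _ _) (overlap_le_right _ _)⟩
  have hσ : 1 + δ / 4 ≤ (1 - (1 + ε) / 2) * (2 + δ) := by linarith
  have key := hmodel.recovery hδ hσ hmlow hnlow hI hJ hM hN hl hscan (hlm0.trans hr0)
    (hln0.trans hc0) hr hc
  refine le_trans ?_ key
  have hv : 0 < v := hmodel.var_pos
  have t1 : Real.exp (-(μ ^ 2 * side (I, J) ^ 2 / (2000000 * v)))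
      ≤ Real.exp (-(Real.log I.card / 100000)) := by
    rw [Real.exp_le_exp, neg_le_neg_iff, side_sq, div_le_div_iff₀ (by norm_num) (by positivity)]
    have h1 : 26 * v * Real.log I.card ≤ μ ^ 2 * J.card :=
      (mul_le_mul_of_nonneg_left hr0 (by positivity)).trans hr
    have h2 : μ ^ 2 * J.card ≤ μ ^ 2 * J.card * I.card :=
      le_mul_of_one_le_right (by positivity) hm1
    have h3 : 0 ≤ v * Real.log I.card := by positivity
    change Real.log I.card * (2000000 * v) ≤ μ ^ 2 * (I.card * J.card) * 100000
    linarith only [h1, h2, h3]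
  have t2 := exp_neg_mul_succ_le hδ hM0 hN0
  have t3 : (1 + Real.exp (-ℓr)) ^ M * (1 + Real.exp (-ℓc)) ^ N ≤
      Real.exp (2 / (I.card : ℝ) + 2 / (J.card : ℝ)) := by
    rw [Real.exp_add]
    exact mul_le_mul (one_add_exp_pow_le hm0 hM) (one_add_exp_pow_le hn0 hN) (by positivity)
      (by positivity)
  rw [recoveryError]
  linarith

/-! ### Passage to the limit. -/

lemma tendsto_recoveryError {δ : ℝ} (hδ : 0 < δ) {M m n : ℕ → ℕ} (hM : Tendsto M atTop atTop)
    (hm : Tendsto m atTop atTop) (hn : Tendsto n atTop atTop) :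
    Tendsto (fun k => recoveryError δ (M k) (m k) (n k)) atTop (𝓝 0) := by
  have hlog : ∀ {u : ℕ → ℕ}, Tendsto u atTop atTop →
      Tendsto (fun k => Real.log (u k)) atTop atTop := fun hu =>
    Real.tendsto_log_atTop.comp (tendsto_natCast_atTop_atTop.comp hu)
  have hinv : ∀ {u : ℕ → ℕ}, Tendsto u atTop atTop →
      Tendsto (fun k => 2 / (u k : ℝ)) atTop (𝓝 0) := fun hu =>
    (tendsto_natCast_atTop_atTop.comp hu).const_div_atTop 2
  have h1 : Tendsto (fun k => Real.exp (-(Real.log (m k) / 100000))) atTop (𝓝 0) :=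
    Real.tendsto_exp_neg_atTop_nhds_zero.comp ((hlog hm).atTop_div_const (by norm_num))
  have h2 : Tendsto (fun k => Real.exp (-(δ / 4 * Real.log (M k)))) atTop (𝓝 0) :=
    Real.tendsto_exp_neg_atTop_nhds_zero.comp ((hlog hM).const_mul_atTop (by linarith))
  have h3 : Tendsto (fun k => Real.exp (2 / (m k : ℝ) + 2 / (n k : ℝ))) atTop (𝓝 1) := by
    have := (Real.continuous_exp.tendsto _).comp ((hinv hm).add (hinv hn))
    rwa [add_zero, Real.exp_zero] at this
  have := ((h1.const_mul 2).add (h2.const_mul 4)).add (h3.sub_const 1)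
  simpa [recoveryError] using this

theorem theorem4
    (ν : Measure ℝ) [IsProbabilityMeasure ν]
    (hν_L2 : MemLp (fun x : ℝ => x) 2 ν)
    (hν_mean : ∫ x, x ∂ν = 0)
    (hν_var : variance (fun x : ℝ => x) ν = 1)
    (δ : ℝ) (hδ : 0 < δ)
    (C : ℝ) (hC : 1 < C)
    (hC_eq : C = 2 * ((C / (C - 1)) ^ (1.5 : ℝ) + (C / (C - 1)) ^ (1.25 : ℝ)))
    (M N mstar nstar mlow nlow : ℕ → ℕ)
    (hM : Tendsto M atTop atTop) (hN : Tendsto N atTop atTop)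
    (hmstar : Tendsto mstar atTop atTop) (hnstar : Tendsto nstar atTop atTop)
    (hsparse : Tendsto
      (fun k => max (mstar k : ℝ) (nstar k : ℝ) / min (M k : ℝ) (N k : ℝ)) atTop (𝓝 0))
    (hlog : Tendsto
      (fun k => max (Real.log (M k : ℝ)) (Real.log (N k : ℝ)) / min (mstar k : ℝ) (nstar k : ℝ))
      atTop (𝓝 0))
    (hmlow : (fun k => Real.log (N k : ℝ)) =o[atTop] (fun k => (mlow k : ℝ)))
    (hnlow : (fun k => Real.log (M k : ℝ)) =o[atTop] (fun k => (nlow k : ℝ)))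
    (hmlow_le : ∀ k, mlow k ≤ mstar k) (hnlow_le : ∀ k, nlow k ≤ nstar k)
    (Istar : ∀ k, Finset (Fin (M k))) (Jstar : ∀ k, Finset (Fin (N k)))
    (hIstar : ∀ k, (Istar k).card = mstar k) (hJstar : ∀ k, (Jstar k).card = nstar k)
    (θ : ℕ → ℝ) (b : ℝ) (hb : (b : EReal) < thetaStar ν)
    (hθ : ∀ k, 0 ≤ θ k ∧ θ k ≤ b)
    (hsignal : 1 < liminf
      (fun k => ((θ k / thetaOne C δ (M k) (N k) (mstar k) (nstar k) : ℝ) : EReal)) atTop)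
    {Ω : ℕ → Type*} [∀ k, MeasurableSpace (Ω k)]
    (P : ∀ k, Measure (Ω k)) [∀ k, IsProbabilityMeasure (P k)]
    (X : ∀ k, Fin (M k) → Fin (N k) → Ω k → ℝ)
    (hindep : ∀ k, iIndepFun (fun p : Fin (M k) × Fin (N k) => X k p.1 p.2) (P k))
    (hin : ∀ k i j, i ∈ Istar k ∧ j ∈ Jstar k → HasLaw (X k i j) (expFamily ν (θ k)) (P k))
    (hout : ∀ k i j, ¬ (i ∈ Istar k ∧ j ∈ Jstar k) → HasLaw (X k i j) ν (P k)) :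
    Tendsto
      (fun k => P k {ω | scanArgmax δ (mlow k) (nlow k) (fun i j => X k i j ω)
        = {(Istar k, Jstar k)}})
      atTop (𝓝 1) := by
  have hC52 := threshold_constant_gt hC hC_eq
  -- The first bound leaves room in the numerical constants; the second gives `(1 - (1 + ε) / 2) *
  -- (2 + δ) ≥ 1 + δ / 4`.
  set ε : ℝ := min (1 / 100) (δ / (2 * (2 + δ))) with hεdef
  have hε : 0 < ε := by positivity
  have hε1 : ε ≤ 1 / 100 := min_le_left _ _
  have hεδ : ε * (2 * (2 + δ)) ≤ δ := (le_div_iff₀ (by positivity)).1 (min_le_right _ _)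
  obtain ⟨s₀, hs₀, c₀, hc₀, K, hK, hν, hfam⟩ := exists_subgaussian_expFamily hν_L2 hν_mean hν_var hb
    ((hθ 0).1.trans (hθ 0).2) hε (by linarith)
  have hK0 : 0 < K := by linarith
  -- Target ratio of penalty to side: below `s₀` the scan tilt is admissible, and below `c₀ / (500 *
  -- K)` penalties are negligible when the planted mean is at least `c₀`.
  set η : ℝ := min s₀ (c₀ / (500 * K)) with hηdef
  have hη : 0 < η := by positivity
  have hηc : 500 * K * η ≤ c₀ := by
    rw [mul_comm]
    exact (le_div_iff₀ (by positivity)).1 (min_le_right _ _)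
  set τ : ℝ := min (η ^ 2 / (4 * (2 + δ))) (c₀ ^ 2 / (52 * K)) with hτdef
  have hτ : 0 < τ := by positivity
  have hτη : 4 * (2 + δ) * τ ≤ η ^ 2 := by
    rw [mul_comm]
    exact (le_div_iff₀ (by positivity)).1 (min_le_left _ _)
  have hτc : 52 * K * τ ≤ c₀ ^ 2 := by
    rw [mul_comm]
    exact (le_div_iff₀ (by positivity)).1 (min_le_right _ _)
  have hlow : ∀ {u l : ℕ → ℕ}, Tendsto u atTop atTop →
      (fun k => Real.log (u k : ℝ)) =o[atTop] (fun k => (l k : ℝ)) →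
      ∀ᶠ k in atTop, Real.log (u k) ≤ τ * l k ∧ 0 < l k := by
    intro u l hu hul
    filter_upwards [hul.bound hτ, hu.eventually_ge_atTop 2] with k hk hk2
    have hpos : 0 < Real.log (u k) := Real.log_pos (by exact_mod_cast hk2)
    rw [Real.norm_eq_abs, abs_of_pos hpos, Real.norm_natCast] at hk
    -- A positive logarithm cannot be bounded by a multiple of `0`, so empty submatrices are
    -- eventually not scanned.
    refine ⟨hk, Nat.pos_of_ne_zero fun h0 => ?_⟩
    rw [h0, Nat.cast_zero, mul_zero] at hk
    linarith
  have hbound : ∀ᶠ k in atTop, 1 - recoveryError δ (M k) (mstar k) (nstar k) ≤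
      (P k).real {ω | scanArgmax δ (mlow k) (nlow k) (fun i j => X k i j ω)
        = {(Istar k, Jstar k)}} := by
    filter_upwards [hlow hN hmlow, hlow hM hnlow,
      hsparse.eventually_lt_const (show (0 : ℝ) < 1 / 4 by norm_num),
      hM.eventually_ge_atTop 1, hN.eventually_ge_atTop 1,
      eventually_lt_of_lt_liminf hsignal] with k h1 h2 h3 h4 h5 h6
    have hM1 : (0 : ℝ) < M k := by exact_mod_cast h4
    have hN1 : (0 : ℝ) < N k := by exact_mod_cast h5
    rw [div_lt_iff₀ (lt_min hM1 hN1)] at h3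
    have h4M : 4 * (Istar k).card ≤ M k := by
      have : 4 * ((Istar k).card : ℝ) ≤ M k := by
        rw [hIstar]
        linarith [le_max_left (mstar k : ℝ) (nstar k : ℝ), min_le_left (M k : ℝ) (N k : ℝ)]
      exact_mod_cast this
    have h4N : 4 * (Jstar k).card ≤ N k := by
      have : 4 * ((Jstar k).card : ℝ) ≤ N k := by
        rw [hJstar]
        linarith [le_max_right (mstar k : ℝ) (nstar k : ℝ), min_le_right (M k : ℝ) (N k : ℝ)]
      exact_mod_cast this
    have h6' : 1 < θ k / thetaOne C δ (M k) (N k) (mstar k) (nstar k) := by exact_mod_cast h6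
    have hth0 : 0 ≤ thetaOne C δ (M k) (N k) (mstar k) (nstar k) :=
      mul_nonneg (by linarith) ((Real.sqrt_nonneg _).trans (le_max_left _ _))
    -- Division by zero gives `0`, so a ratio above `1` forces a positive threshold, and hence `θ k
    -- > 0`.
    have hth : 0 < thetaOne C δ (M k) (N k) (mstar k) (nstar k) := by
      refine hth0.lt_of_ne fun h0 => ?_
      rw [← h0, div_zero] at h6'
      linarith
    have hθ1 := (one_lt_div hth).1 h6'
    obtain ⟨μ, v, hμv, hμ, hμs, hνθ⟩ := hfam (θ k) (hth.trans hθ1) (hθ k).2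
    rw [← hIstar k, ← hJstar k]
    exact one_sub_recoveryError_le hδ hε hε1 hεδ hs₀ hc₀ hK hη (min_le_left _ _) hηc hτη hτc
      hC52.le hν hμv hμ hμs hνθ h1.2 h2.2 ((hmlow_le k).trans (hIstar k).ge)
      ((hnlow_le k).trans (hJstar k).ge) h4M h4N h2.1 h1.1
      (by rw [hIstar, hJstar]; exact hθ1.le) (hindep k) (hin k) (hout k)
  have hreal : Tendsto (fun k => (P k).real {ω | scanArgmax δ (mlow k) (nlow k)
      (fun i j => X k i j ω) = {(Istar k, Jstar k)}}) atTop (𝓝 1) := by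
    refine tendsto_of_tendsto_of_tendsto_of_le_of_le' ?_ tendsto_const_nhds hbound
      (Eventually.of_forall fun k => measureReal_le_one)
    simpa using (tendsto_recoveryError hδ hM hmstar hnstar).const_sub 1
  have h := ENNReal.tendsto_ofReal hreal
  rw [ENNReal.ofReal_one] at h
  refine h.congr fun k => ?_
  exact ofReal_measureReal
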